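/- Let $N\ge 2$, let $\Omega\subset\mathbb R^N$ be a bounded open set, and let $\mu^+$ be a finite Borel measure on $\Sigma:=[0,1]\times(1,N)$ such that $\mu^+([\overline s,1]\times[\overline p,N))>0$ for some $(\overline s,\overline p)\in(0,1]\times(1,N)$. For $(s,p)\in\Sigma$ and $u\in C_c^\infty(\Omega)$ (extended by zero to $\mathbb R^N$) set $[u]_{0,p}:=\|u\|_{L^p(\mathbb R^N)}$, $[u]_{1,p}:=\|\nabla u\|_{L^p(\mathbb R^N)}$ and, for $s\in(0,1)$, $$[u]_{s,p}:=\left(c_{N,s,p}\iint_{\mathbb R^{2N}}\frac{|u(x)-u(y)|^p}{|x-y|^{N+sp}}\,dx\,dy\right)^{1/p},\qquad c_{N,s,p}:=\frac{s\,2^{2s}\,\Gamma\left(\frac{ps+p+N-2}{2}\right)}{\pi^{N/2}\,\Gamma(1-s)} .$$ Let $\mathcal X_\mu(\Omega)$ be the completion of $C_c^\infty(\Omega)$ with respect to the norm $\|u\|_\mu:=\iint_\Sigma[u]_{s,p}\,d\mu^+(s,p)$. Let $W_0^{1,p}(\Omega)$ be the closure of $C_c^\infty(\Omega)$ in $W^{1,p}(\Omega)$,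 with norm $\|u\|_{L^p(\Omega)}+\|\nabla u\|_{L^p(\Omega)}$, and, for $s\in(0,1)$, let $W_0^{s,p}(\Omega)$ be the closure of $C_c^\infty(\Omega)$ (functions being extended by zero outside $\Omega$) in $W^{s,p}(\mathbb R^N)$, with norm $\|u\|_{L^p(\mathbb R^N)}+[u]_{s,p}$. Then the elements of $\mathcal X_\mu(\Omega)$ are identified with (classes of) measurable functions on $\Omega$, by an injective linear map that extends the inclusion of $C_c^\infty(\Omega)$, in such a way that the following holds. (a) Let $(s_\sharp,p_\sharp)\in[\overline s,1]\times[\overline p,N)$ be such that $\mu^+([s_\sharp,1]\times[p_\sharp,N))>0$. - If $s_\sharp=1$, there exists $C=C(p_\sharp,N,\Omega,\mu^+)>0$ such that every $u\in\mathcal X_\mu(\Omega)$ belongs to $W_0^{1,p_\sharp}(\Omega)$ and $\|u\|_{W_0^{1,p_\sharp}(\Omega)}\le C\|u\|_\mu$; that is, $\mathcal X_\mu(\Omega)$ is continuously embedded in $W_0^{1,p_\sharp}(\Omega)$. - If $s_\sharp<1$, set $(p_\sharp)^*_{s_\sharp}:=\frac{Np_\sharp}{N-s_\sharp p_\sharp}$.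 There exists $C=C(s_\sharp,p_\sharp,N,\Omega,\mu^+)>0$ such that every $u\in\mathcal X_\mu(\Omega)$ belongs to $L^{(p_\sharp)^*_{s_\sharp}}(\Omega)$ and $\|u\|_{L^{(p_\sharp)^*_{s_\sharp}}(\Omega)}\le C\|u\|_\mu$; that is, $\mathcal X_\mu(\Omega)$ is continuously embedded in $L^{(p_\sharp)^*_{s_\sharp}}(\Omega)$. (b) If $(s_1,p_1)\in(0,1)\times(1,N)$ satisfies $\mu^+([s_1,1)\times\{p_1\})>0$, there exists $C=C(s_1,p_1,N,\Omega,\mu^+)>0$ such that every $u\in\mathcal X_\mu(\Omega)$ belongs to $W_0^{s_1,p_1}(\Omega)$ and $\|u\|_{W_0^{s_1,p_1}(\Omega)}\le C\|u\|_\mu$; that is, $\mathcal X_\mu(\Omega)$ is continuously embedded in $W_0^{s_1,p_1}(\Omega)$. -/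

import Mathlib

open MeasureTheory Set TopologicalSpace
open scoped ENNReal Distributions

noncomputable section

namespace FracSuperposition

/-- The Euclidean space `ℝ^N`. -/
abbrev Eu (N : ℕ) : Type := EuclideanSpace ℝ (Fin N)

/-- The parameter set `Σ = [0,1] × (1,N)`, with points `(s, p)`. -/
def Sig (N : ℕ) : Set (ℝ × ℝ) := Icc 0 1 ×ˢ Ioo 1 (N : ℝ)

/-- The normalizing constant `c_{N,s,p}`. -/
def fracConst (N : ℕ) (s p : ℝ) : ℝ :=
  s * 2 ^ (2 * s) * Real.Gamma ((p * s + p + N - 2) / 2) /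
    (Real.pi ^ ((N : ℝ) / 2) * Real.Gamma (1 - s))

/-- The normalized Gagliardo seminorm `[u]_{s,p}` for `s ∈ (0,1)`, as an extended real. -/
def gagliardo (N : ℕ) (s p : ℝ) (u : Eu N → ℝ) : ℝ≥0∞ :=
  (ENNReal.ofReal (fracConst N s p) *
    ∫⁻ z : Eu N × Eu N,
      ENNReal.ofReal (|u z.1 - u z.2| ^ p / ‖z.1 - z.2‖ ^ (N + s * p))) ^ (1 / p)

/-- The seminorm `[u]_{s,p}` for `s ∈ [0,1]` and a differentiable function `u` on `ℝ^N`
(it is only used for test functions; at `s = 1` the gradient is the classical one). -/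
def semi (N : ℕ) (s p : ℝ) (u : Eu N → ℝ) : ℝ≥0∞ :=
  if s = 0 then eLpNorm u (ENNReal.ofReal p) volume
  else if s = 1 then eLpNorm (gradient u) (ENNReal.ofReal p) volume
  else gagliardo N s p u

/-- `‖u‖_μ = ∬_Σ [u]_{s,p} dμ(s,p)`. -/
def muNorm {N : ℕ} (μ : Measure (ℝ × ℝ)) (u : Eu N → ℝ) : ℝ≥0∞ :=
  ∫⁻ z in Sig N, semi N z.1 z.2 u ∂μ

/-! ### `‖·‖_μ` is a finite seminorm on test functions -/

section Helpers

variable {N : ℕ} {Ω : Opens (Eu N)}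

theorem contDiff_one (u : 𝓓(Ω, ℝ)) : ContDiff ℝ 1 u := u.contDiff.of_le (by exact_mod_cast le_top)

theorem gradient_add (u v : 𝓓(Ω, ℝ)) : gradient (u + v : Eu N → ℝ) = gradient u + gradient v := by
  funext x
  have hu : DifferentiableAt ℝ u x := (contDiff_one u).differentiable (by simp) x
  have hv : DifferentiableAt ℝ v x := (contDiff_one v).differentiable (by simp) x
  simp [gradient, fderiv_add hu hv]

theorem gradient_smul (c : ℝ) (u : 𝓓(Ω, ℝ)) : gradient (c • u : Eu N → ℝ) = c • gradient u := by
  funext x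
  have hu : DifferentiableAt ℝ u x := (contDiff_one u).differentiable (by simp) x
  simp [gradient, fderiv_const_smul hu]

theorem continuous_gradient (u : 𝓓(Ω, ℝ)) : Continuous (gradient u) := by
  have := (contDiff_one u).continuous_fderiv (by simp)
  unfold gradient
  fun_prop

theorem norm_gradient (u : Eu N → ℝ) (x : Eu N) : ‖gradient u x‖ = ‖fderiv ℝ u x‖ := by
  simp [gradient]

theorem gagliardo_integrand_eq {s p : ℝ} (hp : 1 < p) (u : Eu N → ℝ) (z : Eu N × Eu N) :
    ENNReal.ofReal (|u z.1 - u z.2| ^ p / ‖z.1 - z.2‖ ^ (N + s * p)) =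
      ENNReal.ofReal (|u z.1 - u z.2| / ‖z.1 - z.2‖ ^ ((N + s * p) / p)) ^ p := by
  rw [ENNReal.ofReal_rpow_of_nonneg (by positivity) (by linarith),
    Real.div_rpow (by positivity) (by positivity), ← Real.rpow_mul (by positivity),
    div_mul_cancel₀ _ (by linarith)]

theorem gagliardo_add {s p : ℝ} (hp : 1 < p) {u v : Eu N → ℝ} (hu : Measurable u)
    (hv : Measurable v) :
    gagliardo N s p (u + v) ≤ gagliardo N s p u + gagliardo N s p v := by
  unfold gagliardo
  have h0 : (0 : ℝ) ≤ 1 / p := by positivity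
  simp only [gagliardo_integrand_eq hp, ENNReal.mul_rpow_of_nonneg _ _ h0, ← mul_add]
  gcongr
  refine le_trans ?_ (ENNReal.lintegral_Lp_add_le (by fun_prop) (by fun_prop) hp.le)
  gcongr with z
  simp only [Pi.add_apply]
  rw [← ENNReal.ofReal_add (by positivity) (by positivity), ← add_div]
  gcongr
  rw [add_sub_add_comm]
  exact abs_add_le _ _

theorem gagliardo_smul {s p : ℝ} (hp : 1 < p) (c : ℝ) (u : Eu N → ℝ) :
    gagliardo N s p (c • u) = ENNReal.ofReal |c| * gagliardo N s p u := by
  unfold gagliardo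
  have h0 : (0 : ℝ) ≤ 1 / p := by positivity
  have : ∀ z : Eu N × Eu N,
      ENNReal.ofReal (|(c • u) z.1 - (c • u) z.2| ^ p / ‖z.1 - z.2‖ ^ (N + s * p)) =
      ENNReal.ofReal |c| ^ p * ENNReal.ofReal (|u z.1 - u z.2| ^ p / ‖z.1 - z.2‖ ^ (N + s * p)) := by
    intro z
    rw [ENNReal.ofReal_rpow_of_nonneg (by positivity) (by linarith),
      ← ENNReal.ofReal_mul (by positivity)]
    simp only [Pi.smul_apply, smul_eq_mul, ← mul_sub, abs_mul]
    rw [Real.mul_rpow (by positivity) (by positivity), mul_div_assoc]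
  simp only [this]
  rw [lintegral_const_mul' _ _ (ENNReal.rpow_ne_top_of_nonneg (by linarith) (by simp)),
    mul_left_comm, ENNReal.mul_rpow_of_nonneg _ _ h0, ← ENNReal.rpow_mul,
    mul_one_div_cancel (by linarith), ENNReal.rpow_one]

theorem semi_add {s p : ℝ} (hp : 1 < p) (u v : 𝓓(Ω, ℝ)) :
    semi N s p (u + v : Eu N → ℝ) ≤ semi N s p u + semi N s p v := by
  have hp' : 1 ≤ ENNReal.ofReal p := by simpa using hp.le
  unfold semi
  split_ifs
  · exact eLpNorm_add_le u.continuous.aestronglyMeasurable v.continuous.aestronglyMeasurable hp'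
  · rw [gradient_add]
    exact eLpNorm_add_le (continuous_gradient u).aestronglyMeasurable
      (continuous_gradient v).aestronglyMeasurable hp'
  · exact gagliardo_add hp u.continuous.measurable v.continuous.measurable

theorem semi_smul {s p : ℝ} (hp : 1 < p) (c : ℝ) (u : 𝓓(Ω, ℝ)) :
    semi N s p (c • u : Eu N → ℝ) = ENNReal.ofReal |c| * semi N s p u := by
  unfold semi
  split_ifs
  · rw [eLpNorm_const_smul]; simp [← ofReal_norm]
  · rw [gradient_smul, eLpNorm_const_smul]; simp [← ofReal_norm]
  · exact gagliardo_smul hp c u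

theorem continuousAt_Gamma {x : ℝ} (hx : 0 < x) : ContinuousAt Real.Gamma x :=
  (Real.differentiableAt_Gamma fun m => by
    have : (0 : ℝ) ≤ m := m.cast_nonneg
    linarith).continuousAt

theorem two_le_of_mem {p : ℝ} (h1 : 1 < p) (h2 : p < N) : (2 : ℝ) ≤ N := by
  have : 1 < N := by exact_mod_cast h1.trans h2
  exact_mod_cast this

theorem continuousOn_fracConst : ContinuousOn (fun z : ℝ × ℝ => fracConst N z.1 z.2)
    (Ioo 0 1 ×ˢ Ioo 1 (N : ℝ)) := by
  rintro ⟨s, p⟩ ⟨⟨hs0, hs1⟩, hp1, hpN⟩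
  apply ContinuousAt.continuousWithinAt
  have hN := two_le_of_mem hp1 hpN
  dsimp only at hs0 hs1 hp1 hpN
  have hps : 0 < p * s := by positivity
  have h1 : ContinuousAt (fun z : ℝ × ℝ => Real.Gamma ((z.2 * z.1 + z.2 + N - 2) / 2)) (s, p) :=
    ContinuousAt.comp (f := fun z : ℝ × ℝ => (z.2 * z.1 + z.2 + N - 2) / 2)
      (continuousAt_Gamma (by dsimp only; linarith)) (by fun_prop)
  have h2 : ContinuousAt (fun z : ℝ × ℝ => Real.Gamma (1 - z.1)) (s, p) :=
    ContinuousAt.comp (f := fun z : ℝ × ℝ => 1 - z.1)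
      (continuousAt_Gamma (by dsimp only; linarith)) (by fun_prop)
  have h3 : ContinuousAt (fun z : ℝ × ℝ => (2 : ℝ) ^ (2 * z.1)) (s, p) :=
    ContinuousAt.rpow (by fun_prop) (by fun_prop) (by simp)
  unfold fracConst
  refine ContinuousAt.div (by fun_prop) (by fun_prop) ?_
  have : 0 < Real.Gamma (1 - s) := Real.Gamma_pos_of_pos (by linarith)
  positivity

theorem aemeasurable_semi (μ : Measure (ℝ × ℝ)) (u : 𝓓(Ω, ℝ)) :
    AEMeasurable (fun z : ℝ × ℝ => semi N z.1 z.2 u) (μ.restrict (Sig N)) := by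
  have hu := u.continuous.measurable
  have hg := (continuous_gradient u).measurable
  have hsplit : Sig N = ({0} ×ˢ Ioo 1 (N : ℝ) ∪ {1} ×ˢ Ioo 1 (N : ℝ)) ∪
      Ioo 0 1 ×ˢ Ioo 1 (N : ℝ) := by
    rw [← union_prod, ← union_prod, Sig]
    congr 1
    ext s
    simp only [mem_Icc, mem_union, mem_singleton_iff, mem_Ioo]
    constructor
    · rintro ⟨h0, h1⟩
      rcases h0.eq_or_lt with h | h
      · exact Or.inl (Or.inl h.symm)
      rcases h1.eq_or_lt with h' | h'
      · exact Or.inl (Or.inr h')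
      exact Or.inr ⟨h, h'⟩
    · rintro ((rfl | rfl) | ⟨h, h'⟩)
      · simp
      · simp
      · exact ⟨h.le, h'.le⟩
  have key : ∀ {F : Type} [NormedAddCommGroup F] [MeasurableSpace F] [BorelSpace F]
      (f : Eu N → F), Measurable f → ∀ (t : Set ℝ), MeasurableSet t →
      AEMeasurable (fun z : ℝ × ℝ => eLpNorm f (ENNReal.ofReal z.2) volume)
        (μ.restrict (t ×ˢ Ioo 1 (N : ℝ))) := by
    intro F _ _ _ f hf t ht
    have hm : Measurable fun z : ℝ × ℝ => (∫⁻ x, ‖f x‖ₑ ^ z.2) ^ (1 / z.2) := by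
      refine Measurable.pow (Measurable.lintegral_prod_right' (f := fun q : (ℝ × ℝ) × Eu N =>
        ‖f q.2‖ₑ ^ q.1.2) ?_) (by fun_prop)
      exact Measurable.pow (by fun_prop) (by fun_prop)
    refine hm.aemeasurable.congr ?_
    filter_upwards [ae_restrict_mem (ht.prod measurableSet_Ioo)] with z hz
    have hz1 : 1 < z.2 := hz.2.1
    rw [eLpNorm_eq_lintegral_rpow_enorm_toReal (by simp; linarith) (by simp),
      ENNReal.toReal_ofReal (by linarith)]
  rw [hsplit, aemeasurable_union_iff, aemeasurable_union_iff]
  refine ⟨⟨?_, ?_⟩, ?_⟩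
  · refine (key u hu _ (measurableSet_singleton 0)).congr ?_
    filter_upwards [ae_restrict_mem ((measurableSet_singleton 0).prod measurableSet_Ioo)] with z hz
    have : z.1 = 0 := hz.1
    simp [semi, this]
  · refine (key _ hg _ (measurableSet_singleton 1)).congr ?_
    filter_upwards [ae_restrict_mem ((measurableSet_singleton 1).prod measurableSet_Ioo)] with z hz
    have : z.1 = 1 := hz.1
    simp [semi, this]
  · have hS : MeasurableSet (Ioo (0 : ℝ) 1 ×ˢ Ioo 1 (N : ℝ)) :=
      measurableSet_Ioo.prod measurableSet_Ioo
    have hc := (continuousOn_fracConst (N := N)).aemeasurable (μ := μ) hS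
    have hm : Measurable fun z : ℝ × ℝ => ∫⁻ w : Eu N × Eu N,
        ENNReal.ofReal (|u w.1 - u w.2| ^ z.2 / ‖w.1 - w.2‖ ^ (N + z.1 * z.2)) := by
      refine Measurable.lintegral_prod_right' (f := fun q : (ℝ × ℝ) × (Eu N × Eu N) =>
        ENNReal.ofReal (|u q.2.1 - u q.2.2| ^ q.1.2 / ‖q.2.1 - q.2.2‖ ^ (N + q.1.1 * q.1.2))) ?_
      refine ENNReal.measurable_ofReal.comp (Measurable.div ?_ ?_)
      · refine Measurable.pow ?_ (by fun_prop)
        exact ((hu.comp (by fun_prop)).sub (hu.comp (by fun_prop))).abs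
      · exact Measurable.pow (by fun_prop) (by fun_prop)
    refine ((hc.ennreal_ofReal.mul hm.aemeasurable).pow
      (g := fun z : ℝ × ℝ => 1 / z.2) (by fun_prop)).congr ?_
    filter_upwards [ae_restrict_mem hS] with z hz
    have h0 : z.1 ≠ 0 := hz.1.1.ne'
    have h1 : z.1 ≠ 1 := hz.1.2.ne
    simp [semi, h0, h1, gagliardo]

theorem fracConst_le : ∃ K : ℝ, 0 ≤ K ∧ ∀ s p : ℝ, 0 < s → s < 1 → 1 < p → p < N →
    fracConst N s p ≤ K * (s * (1 - s)) := by
  obtain ⟨M, hM⟩ := (isCompact_Icc (a := (1 / 2 : ℝ)) (b := 3 * N / 2)).bddAbove_image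
    (f := Real.Gamma) fun x hx => (continuousAt_Gamma (by linarith [hx.1])).continuousWithinAt
  obtain ⟨x₀, hx₀, hmin⟩ := (isCompact_Icc (a := (1 : ℝ)) (b := 2)).exists_isMinOn
    (by simp) (f := Real.Gamma)
    fun x hx => (continuousAt_Gamma (by linarith [hx.1])).continuousWithinAt
  have hm : 0 < Real.Gamma x₀ := Real.Gamma_pos_of_pos (by linarith [hx₀.1])
  set m := Real.Gamma x₀
  refine ⟨4 * |M| / (Real.pi ^ ((N : ℝ) / 2) * m), by positivity, fun s p hs0 hs1 hp1 hpN => ?_⟩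
  have hN := two_le_of_mem hp1 hpN
  have hps : 0 < p * s := by positivity
  have hps' : p * s < p := by nlinarith
  have hG1 : Real.Gamma ((p * s + p + N - 2) / 2) ≤ |M| :=
    (hM ⟨_, ⟨by linarith, by linarith⟩, rfl⟩).trans (le_abs_self M)
  have hG2 : m ≤ Real.Gamma (2 - s) := hmin ⟨by linarith, by linarith⟩
  have hG3 : Real.Gamma (2 - s) = (1 - s) * Real.Gamma (1 - s) := by
    rw [← Real.Gamma_add_one (by linarith)]; congr 1; ring
  have hG4 : 0 < Real.Gamma (1 - s) := Real.Gamma_pos_of_pos (by linarith)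
  have h4 : (2 : ℝ) ^ (2 * s) ≤ 4 := by
    calc (2 : ℝ) ^ (2 * s) ≤ 2 ^ (2 : ℝ) := Real.rpow_le_rpow_of_exponent_le (by norm_num) (by linarith)
      _ = 4 := by norm_num
  have h1s : 0 < 1 - s := by linarith
  have e : fracConst N s p = (2 ^ (2 * s) * Real.Gamma ((p * s + p + N - 2) / 2) /
      (Real.pi ^ ((N : ℝ) / 2) * Real.Gamma (2 - s))) * (s * (1 - s)) := by
    rw [hG3, fracConst]
    field_simp
  have hG5 : 0 ≤ Real.Gamma ((p * s + p + N - 2) / 2) :=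
    (Real.Gamma_pos_of_pos (by linarith)).le
  rw [e]
  gcongr

/-- Radial integral in polar coordinates. -/
theorem lintegral_radial (hN : 1 ≤ N) {s p : ℝ} (hs0 : 0 < s) (hs1 : s < 1) (hp1 : 1 < p) :
    ∫⁻ x : Eu N, ENNReal.ofReal (min ‖x‖ 1 ^ p / ‖x‖ ^ (N + s * p)) =
      ENNReal.ofReal (N * volume.real (Metric.ball (0 : Eu N) 1) / (p * (s * (1 - s)))) := by
  have : Nonempty (Fin N) := ⟨⟨0, hN⟩⟩
  have hp0 : 0 < p := by linarith
  have hsp : 0 < s * p := by positivity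
  have h1s : 0 < 1 - s := by linarith
  set f : ℝ → ℝ := fun r => min r 1 ^ p / r ^ (N + s * p) with hf
  have e1 : EqOn (fun r : ℝ => r ^ (N - 1) • f r) (fun r => r ^ (p * (1 - s) - 1)) (Ioc 0 1) := by
    intro r hr
    have hr0 : 0 < r := hr.1
    simp only [hf, smul_eq_mul, min_eq_left hr.2]
    rw [← Real.rpow_natCast, ← mul_div_assoc, ← Real.rpow_add hr0, ← Real.rpow_sub hr0,
      Nat.cast_sub hN]
    congr 1; push_cast; ring
  have e2 : EqOn (fun r : ℝ => r ^ (N - 1) • f r) (fun r => r ^ (-1 - s * p)) (Ioi 1) := by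
    intro r hr
    have hr1 : 1 < r := hr
    have hr0 : 0 < r := by linarith
    simp only [hf, smul_eq_mul, min_eq_right hr1.le, Real.one_rpow]
    rw [← Real.rpow_natCast, ← mul_div_assoc, mul_one, ← Real.rpow_sub hr0, Nat.cast_sub hN]
    congr 1; push_cast; ring
  have hlt : -1 < p * (1 - s) - 1 := by nlinarith [mul_pos hp0 h1s]
  have i1 : IntegrableOn (fun r : ℝ => r ^ (N - 1) • f r) (Ioc 0 1) := by
    rw [integrableOn_congr_fun e1 measurableSet_Ioc, ← intervalIntegrable_iff_integrableOn_Ioc_of_le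
      zero_le_one]
    exact intervalIntegral.intervalIntegrable_rpow' hlt
  have i2 : IntegrableOn (fun r : ℝ => r ^ (N - 1) • f r) (Ioi 1) := by
    rw [integrableOn_congr_fun e2 measurableSet_Ioi]
    exact integrableOn_Ioi_rpow_of_lt (by linarith) one_pos
  have hint : ∫ r in Ioi (0 : ℝ), r ^ (N - 1) • f r = 1 / (p * (s * (1 - s))) := by
    rw [← Ioc_union_Ioi_eq_Ioi (zero_le_one (α := ℝ)), setIntegral_union
      (Ioc_disjoint_Ioi le_rfl) measurableSet_Ioi i1 i2, setIntegral_congr_fun measurableSet_Ioc e1,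
      setIntegral_congr_fun measurableSet_Ioi e2, integral_Ioi_rpow_of_lt (by linarith) one_pos,
      ← intervalIntegral.integral_of_le zero_le_one, integral_rpow (Or.inl hlt)]
    have : p * (1 - s) - 1 + 1 = p * (1 - s) := by ring
    rw [this, Real.zero_rpow (by positivity)]
    have : -1 - s * p + 1 = - (s * p) := by ring
    rw [this]
    simp only [Real.one_rpow]
    field_simp
    ring
  have hI : Integrable (fun x : Eu N => f ‖x‖) := by
    rw [integrable_fun_norm_addHaar]
    simp only [finrank_euclideanSpace, Fintype.card_fin]
    rw [← Ioc_union_Ioi_eq_Ioi (zero_le_one (α := ℝ))]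
    exact i1.union i2
  rw [← ofReal_integral_eq_lintegral_ofReal hI
    (ae_of_all _ fun x => by simp only [hf]; positivity), integral_fun_norm_addHaar]
  simp only [finrank_euclideanSpace, Fintype.card_fin]
  rw [hint]
  simp only [nsmul_eq_mul, smul_eq_mul]
  congr 1; ring

theorem semi_bounded (u : 𝓓(Ω, ℝ)) : ∃ B : ℝ≥0∞, B ≠ ∞ ∧ ∀ z ∈ Sig N, semi N z.1 z.2 u ≤ B := by
  obtain ⟨A₁, hA₁⟩ := u.continuous.bounded_above_of_compact_support u.hasCompactSupport
  have hdc := (contDiff_one u).continuous_fderiv (by simp)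
  obtain ⟨A₂, hA₂⟩ := hdc.bounded_above_of_compact_support (u.hasCompactSupport.fderiv (𝕜 := ℝ))
  obtain ⟨K, hK0, hK⟩ := fracConst_le (N := N)
  set A : ℝ := max 1 (max (2 * A₁) A₂) with hA
  have hA1 : 1 ≤ A := le_max_left _ _
  have hAu : ∀ x, ‖u x‖ ≤ A := fun x => (hA₁ x).trans <| by
    have : 0 ≤ A₁ := (norm_nonneg _).trans (hA₁ x)
    exact le_trans (by linarith) ((le_max_left _ _).trans (le_max_right _ _))
  have hAd : ∀ x, ‖fderiv ℝ u x‖ ≤ A := fun x =>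
    (hA₂ x).trans ((le_max_right _ _).trans (le_max_right _ _))
  have hdiff : ∀ x y, |u x - u y| ≤ A * min ‖x - y‖ 1 := by
    intro x y
    rw [mul_min_of_nonneg _ _ (by linarith), mul_one]
    refine le_min ?_ ?_
    · exact Convex.norm_image_sub_le_of_norm_fderiv_le (𝕜 := ℝ) (s := univ)
        (fun z _ => (contDiff_one u).differentiable (by simp) z) (fun z _ => hAd z) convex_univ
        (mem_univ y) (mem_univ x)
    · refine le_trans ?_ ((le_max_left _ _).trans (le_max_right _ _))
      have h1 := hA₁ x
      have h2 := hA₁ y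
      have := norm_sub_le (u x) (u y)
      rw [Real.norm_eq_abs] at this
      linarith
  set V : Set (Eu N) := tsupport u with hV
  have hVc : IsCompact V := u.hasCompactSupport
  have hVm : MeasurableSet V := hVc.measurableSet
  have hVt : volume V ≠ ∞ := hVc.measure_lt_top.ne
  have hu0 : ∀ x ∉ V, u x = 0 := fun x hx => image_eq_zero_of_notMem_tsupport hx
  have hg0 : ∀ x ∉ V, gradient u x = 0 := fun x hx => by
    have : fderiv ℝ u x = 0 := by
      have := support_fderiv_subset ℝ (f := u)
      by_contra h
      exact hx (this h)
    simp [gradient, this]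
  have hroot : ∀ (a : ℝ≥0∞) {p : ℝ}, 1 < p → a ^ (1 / p) ≤ max 1 a := by
    intro a p hp
    rcases le_total a 1 with h | h
    · exact (ENNReal.rpow_le_one h (by positivity)).trans (le_max_left _ _)
    · refine le_trans ?_ (le_max_right _ _)
      calc a ^ (1 / p) ≤ a ^ (1 : ℝ) := ENNReal.rpow_le_rpow_of_exponent_le h (by
            rw [div_le_one (by linarith)]; exact hp.le)
        _ = a := ENNReal.rpow_one a
  have hLp : ∀ {F : Type} [NormedAddCommGroup F] (f : Eu N → F), (∀ x, ‖f x‖ ≤ A) →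
      (∀ x ∉ V, f x = 0) → ∀ p : ℝ, 1 < p →
      eLpNorm f (ENNReal.ofReal p) volume ≤ max 1 (volume V) * ENNReal.ofReal A := by
    intro F _ f hfA hf0 p hp
    rw [← eLpNorm_restrict_eq_of_support_subset (s := V) (fun x hx => by
      by_contra h; exact hx (hf0 x h))]
    refine (eLpNorm_le_of_ae_bound (ae_of_all _ hfA)).trans ?_
    gcongr
    rw [ENNReal.toReal_ofReal (by linarith), Measure.restrict_apply_univ, ← one_div]
    exact hroot _ hp
  set ω : ℝ := volume.real (Metric.ball (0 : Eu N) 1)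
  set B₂ : ℝ≥0∞ := ENNReal.ofReal (K * A ^ (N : ℝ) * (N * ω)) * (2 * volume V) with hB₂
  refine ⟨max (max 1 (volume V) * ENNReal.ofReal A) (max 1 B₂), ?_, ?_⟩
  · have : B₂ ≠ ∞ := by
      rw [hB₂]; exact ENNReal.mul_ne_top ENNReal.ofReal_ne_top (ENNReal.mul_ne_top (by simp) hVt)
    have h' : max 1 (volume V) * ENNReal.ofReal A ≠ ∞ :=
      ENNReal.mul_ne_top (by simp [hVt]) ENNReal.ofReal_ne_top
    simp [this, h']
  rintro ⟨s, p⟩ ⟨⟨hs0, hs1⟩, hp1, hpN⟩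
  dsimp only at hs0 hs1 hp1 hpN ⊢
  unfold semi
  split_ifs with h0 h1
  · exact (hLp u hAu hu0 p hp1).trans (le_max_left _ _)
  · exact (hLp _ (fun x => by rw [norm_gradient]; exact hAd x) hg0 p hp1).trans (le_max_left _ _)
  replace hs0 : 0 < s := lt_of_le_of_ne hs0 (Ne.symm h0)
  replace hs1 : s < 1 := lt_of_le_of_ne hs1 h1
  have hN1 : 1 ≤ N := by
    have := two_le_of_mem hp1 hpN
    have : (1 : ℝ) ≤ N := by linarith
    exact_mod_cast this
  refine le_trans ?_ (le_max_right _ _)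
  refine (hroot _ hp1).trans (max_le_max le_rfl ?_)
  set G : Eu N → ℝ≥0∞ := fun x => ENNReal.ofReal (min ‖x‖ 1 ^ p / ‖x‖ ^ (N + s * p)) with hG
  have hGm : Measurable G := by
    refine ENNReal.measurable_ofReal.comp (Measurable.div ?_ ?_)
    · exact Measurable.pow (by fun_prop) (by fun_prop)
    · exact Measurable.pow (by fun_prop) (by fun_prop)
  have hpt : ∀ z : Eu N × Eu N,
      ENNReal.ofReal (|u z.1 - u z.2| ^ p / ‖z.1 - z.2‖ ^ (N + s * p)) ≤
        ENNReal.ofReal (A ^ (N : ℝ)) * (V.indicator 1 z.1 * G (z.1 - z.2) +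
          V.indicator 1 z.2 * G (z.1 - z.2)) := by
    intro z
    by_cases hz : z.1 ∈ V ∨ z.2 ∈ V
    · have hone : (1 : ℝ≥0∞) ≤ V.indicator 1 z.1 + V.indicator 1 z.2 := by
        rcases hz with hz | hz <;> simp [hz]
      rw [← add_mul]
      calc _ ≤ ENNReal.ofReal (A ^ (N : ℝ)) * (1 * G (z.1 - z.2)) := by
            rw [one_mul, hG, ← ENNReal.ofReal_mul (by positivity), ← mul_div_assoc]
            apply ENNReal.ofReal_le_ofReal
            gcongr
            calc |u z.1 - u z.2| ^ p ≤ (A * min ‖z.1 - z.2‖ 1) ^ p := by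
                  gcongr; exact hdiff _ _
              _ = A ^ p * min ‖z.1 - z.2‖ 1 ^ p := Real.mul_rpow (by positivity) (by positivity)
              _ ≤ A ^ (N : ℝ) * min ‖z.1 - z.2‖ 1 ^ p := by
                  gcongr
        _ ≤ _ := by gcongr
    · push Not at hz
      rw [hu0 _ hz.1, hu0 _ hz.2]
      simp [Real.zero_rpow (by linarith : p ≠ 0)]
  have hGint := lintegral_radial hN1 hs0 hs1 hp1
  have hI1 : ∫⁻ z : Eu N × Eu N, V.indicator 1 z.1 * G (z.1 - z.2) = volume V * ∫⁻ x, G x := by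
    rw [Measure.volume_eq_prod, lintegral_prod _ (by
      refine Measurable.aemeasurable (Measurable.mul ?_ (hGm.comp (by fun_prop)))
      exact (measurable_one.indicator hVm).comp measurable_fst)]
    have : ∀ x : Eu N, ∫⁻ y, V.indicator 1 x * G (x - y) = V.indicator 1 x * ∫⁻ y, G y := by
      intro x
      rw [lintegral_const_mul _ (by fun_prop), lintegral_sub_left_eq_self G x]
    simp only [this]
    rw [lintegral_mul_const _ (measurable_one.indicator hVm), lintegral_indicator_one hVm]
  have hI2 : ∫⁻ z : Eu N × Eu N, V.indicator 1 z.2 * G (z.1 - z.2) = volume V * ∫⁻ x, G x := by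
    rw [Measure.volume_eq_prod, lintegral_prod_symm _ (by
      refine Measurable.aemeasurable (Measurable.mul ?_ (hGm.comp (by fun_prop)))
      exact (measurable_one.indicator hVm).comp measurable_snd)]
    have : ∀ y : Eu N, ∫⁻ x, V.indicator 1 y * G (x - y) = V.indicator 1 y * ∫⁻ x, G x := by
      intro y
      rw [lintegral_const_mul _ (by fun_prop), lintegral_sub_right_eq_self G y]
    simp only [this]
    rw [lintegral_mul_const _ (measurable_one.indicator hVm), lintegral_indicator_one hVm]
  have hω : 0 ≤ ω := measureReal_nonneg
  have hss : 0 < s * (1 - s) := mul_pos hs0 (by linarith)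
  calc _ ≤ ENNReal.ofReal (K * (s * (1 - s))) * ∫⁻ z : Eu N × Eu N,
        ENNReal.ofReal (A ^ (N : ℝ)) * (V.indicator 1 z.1 * G (z.1 - z.2) +
          V.indicator 1 z.2 * G (z.1 - z.2)) := by
        gcongr with z
        · exact hK s p hs0 hs1 hp1 hpN
        · exact hpt z
    _ = ENNReal.ofReal (K * (s * (1 - s))) * (ENNReal.ofReal (A ^ (N : ℝ)) *
          (volume V * (∫⁻ x, G x) + volume V * (∫⁻ x, G x))) := by
        rw [lintegral_const_mul' _ _ ENNReal.ofReal_ne_top, lintegral_add_left, hI1, hI2]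
        exact ((measurable_one.indicator hVm).comp measurable_fst).mul (by fun_prop)
    _ = ENNReal.ofReal (K * (s * (1 - s))) * ENNReal.ofReal (A ^ (N : ℝ)) *
          ENNReal.ofReal (N * ω / (p * (s * (1 - s)))) * (2 * volume V) := by
        rw [hG, hGint]; ring
    _ ≤ B₂ := by
        rw [hB₂]
        gcongr
        rw [← ENNReal.ofReal_mul (by positivity), ← ENNReal.ofReal_mul (by positivity)]
        apply ENNReal.ofReal_le_ofReal
        have : K * (s * (1 - s)) * A ^ (N : ℝ) * (N * ω / (p * (s * (1 - s)))) =
          K * A ^ (N : ℝ) * (N * ω) / p := by field_simp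
        rw [this]
        exact div_le_self (by positivity) hp1.le

theorem muNorm_ne_top (μ : Measure (ℝ × ℝ)) [IsFiniteMeasure μ] (u : 𝓓(Ω, ℝ)) :
    muNorm μ (u : Eu N → ℝ) ≠ ∞ := by
  obtain ⟨B, hB, hBz⟩ := semi_bounded u
  have hS : MeasurableSet (Sig N) := measurableSet_Icc.prod measurableSet_Ioo
  refine ne_top_of_le_ne_top ?_ (setLIntegral_mono' hS hBz)
  simpa using ENNReal.mul_ne_top hB (measure_ne_top μ _)

theorem muNorm_add (μ : Measure (ℝ × ℝ)) (u v : 𝓓(Ω, ℝ)) :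
    muNorm μ (u + v : Eu N → ℝ) ≤ muNorm μ (u : Eu N → ℝ) + muNorm μ (v : Eu N → ℝ) := by
  unfold muNorm
  rw [← lintegral_add_left' (aemeasurable_semi μ u)]
  exact setLIntegral_mono' (measurableSet_Icc.prod measurableSet_Ioo)
    fun z hz => semi_add hz.2.1 u v

theorem muNorm_smul (μ : Measure (ℝ × ℝ)) (c : ℝ) (u : 𝓓(Ω, ℝ)) :
    muNorm μ (c • u : Eu N → ℝ) = ENNReal.ofReal |c| * muNorm μ (u : Eu N → ℝ) := by
  unfold muNorm
  rw [← lintegral_const_mul' _ _ ENNReal.ofReal_ne_top]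
  exact setLIntegral_congr_fun (measurableSet_Icc.prod measurableSet_Ioo)
    fun z hz => semi_smul hz.2.1 c u

end Helpers

/-! ### The space `X_μ(Ω)` -/

/-- `C_c^∞(Ω)`, to be equipped with `‖·‖_μ` instead of its usual topology. -/
def PreX {N : ℕ} (_μ : Measure (ℝ × ℝ)) (Ω : Opens (Eu N)) : Type := 𝓓(Ω, ℝ)

instance instAddCommGroupPreX {N : ℕ} (μ : Measure (ℝ × ℝ)) (Ω : Opens (Eu N)) :
    AddCommGroup (PreX μ Ω) :=
  inferInstanceAs (AddCommGroup 𝓓(Ω, ℝ))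

instance instModulePreX {N : ℕ} (μ : Measure (ℝ × ℝ)) (Ω : Opens (Eu N)) :
    Module ℝ (PreX μ Ω) :=
  inferInstanceAs (Module ℝ 𝓓(Ω, ℝ))

/-- `‖·‖_μ` as a seminorm on `C_c^∞(Ω)`. -/
def muSeminorm {N : ℕ} (μ : Measure (ℝ × ℝ)) [IsFiniteMeasure μ] (Ω : Opens (Eu N)) :
    Seminorm ℝ 𝓓(Ω, ℝ) :=
  Seminorm.of (fun u => (muNorm μ (u : Eu N → ℝ)).toReal)
    (fun u v => by
      rw [← ENNReal.toReal_add (muNorm_ne_top μ u) (muNorm_ne_top μ v)]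
      exact ENNReal.toReal_mono
        (ENNReal.add_ne_top.2 ⟨muNorm_ne_top μ u, muNorm_ne_top μ v⟩) (muNorm_add μ u v))
    (fun c u => by
      have h : (muNorm μ ((c • u : 𝓓(Ω, ℝ)) : Eu N → ℝ)) = _ := muNorm_smul μ c u
      rw [h, ENNReal.toReal_mul, ENNReal.toReal_ofReal (abs_nonneg c), Real.norm_eq_abs])

instance instSeminormedPreX {N : ℕ} (μ : Measure (ℝ × ℝ)) [IsFiniteMeasure μ]
    (Ω : Opens (Eu N)) : SeminormedAddCommGroup (PreX μ Ω) :=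
  AddGroupSeminorm.toSeminormedAddCommGroup (muSeminorm μ Ω).toAddGroupSeminorm

instance instNormedSpacePreX {N : ℕ} (μ : Measure (ℝ × ℝ)) [IsFiniteMeasure μ]
    (Ω : Opens (Eu N)) : NormedSpace ℝ (PreX μ Ω) where
  norm_smul_le c u := (map_smul_eq_mul (muSeminorm μ Ω) c u).le

/-- `X_μ(Ω)`, the completion of `C_c^∞(Ω)` with respect to `‖·‖_μ`. Its norm is the extension of
`‖·‖_μ`. -/
abbrev X {N : ℕ} (μ : Measure (ℝ × ℝ)) [IsFiniteMeasure μ] (Ω : Opens (Eu N)) : Type :=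
  UniformSpace.Completion (PreX μ Ω)

/-- The canonical map `C_c^∞(Ω) → X_μ(Ω)`. -/
def toX {N : ℕ} (μ : Measure (ℝ × ℝ)) [IsFiniteMeasure μ] {Ω : Opens (Eu N)} (φ : 𝓓(Ω, ℝ)) :
    X μ Ω :=
  ((show PreX μ Ω from φ : PreX μ Ω) : UniformSpace.Completion (PreX μ Ω))

theorem norm_toX {N : ℕ} (μ : Measure (ℝ × ℝ)) [IsFiniteMeasure μ] {Ω : Opens (Eu N)}
    (φ : 𝓓(Ω, ℝ)) : ENNReal.ofReal ‖toX μ φ‖ = muNorm μ (φ : Eu N → ℝ) := by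
  have h : ‖toX μ φ‖ = (muNorm μ (φ : Eu N → ℝ)).toReal := UniformSpace.Completion.norm_coe _
  rw [h, ENNReal.ofReal_toReal (muNorm_ne_top μ φ)]

/-! ### Sobolev spaces with zero boundary values -/

/-- `g` is the weak gradient of `f` in `Ω`. -/
def HasWeakGradient {N : ℕ} (Ω : Opens (Eu N)) (f : Eu N → ℝ) (g : Eu N → Eu N) : Prop :=
  LocallyIntegrableOn f (Ω : Set (Eu N)) ∧ LocallyIntegrableOn g (Ω : Set (Eu N)) ∧
    ∀ φ : 𝓓(Ω, ℝ), ∫ x in (Ω : Set (Eu N)), f x • gradient φ x =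
      -∫ x in (Ω : Set (Eu N)), φ x • g x

/-- The norm `‖f‖_{L^p(Ω)} + ‖∇f‖_{L^p(Ω)}` of `W^{1,p}(Ω)`, where `∇f` is the (a.e. unique) weak
gradient; it is `∞` if there is none. -/
def sobolevNorm {N : ℕ} (Ω : Opens (Eu N)) (p : ℝ) (f : Eu N → ℝ) : ℝ≥0∞ :=
  eLpNorm f (ENNReal.ofReal p) (volume.restrict (Ω : Set (Eu N))) +
    ⨅ (g : Eu N → Eu N) (_ : HasWeakGradient Ω f g),
      eLpNorm g (ENNReal.ofReal p) (volume.restrict (Ω : Set (Eu N)))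

/-- Classes of measurable functions on `Ω` up to equality a.e. -/
abbrev MeasFun {N : ℕ} (Ω : Opens (Eu N)) : Type :=
  Eu N →ₘ[volume.restrict (Ω : Set (Eu N))] ℝ

/-- `W_0^{1,p}(Ω)`: the closure of `C_c^∞(Ω)` in `W^{1,p}(Ω)`. -/
def W01 {N : ℕ} (Ω : Opens (Eu N)) (p : ℝ) : Set (MeasFun Ω) :=
  {f | ∀ ε : ℝ≥0∞, 0 < ε → ∃ φ : 𝓓(Ω, ℝ), sobolevNorm Ω p (fun x => f x - φ x) < ε}

/-- The norm `‖f‖_{L^p(ℝ^N)} + [f]_{s,p}` of `W^{s,p}(ℝ^N)`, for `s ∈ (0,1)`. -/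
def fracSobolevNorm {N : ℕ} (s p : ℝ) (f : Eu N → ℝ) : ℝ≥0∞ :=
  eLpNorm f (ENNReal.ofReal p) volume + gagliardo N s p f

/-- The extension by zero outside `Ω` of a function on `Ω`. -/
def zeroExt {N : ℕ} {Ω : Opens (Eu N)} (f : MeasFun Ω) : Eu N → ℝ :=
  (Ω : Set (Eu N)).indicator f

/-- `W_0^{s,p}(Ω)` for `s ∈ (0,1)`: the functions on `Ω` whose extension by zero is in the closure
of `C_c^∞(Ω)` in `W^{s,p}(ℝ^N)`. -/
def W0s {N : ℕ} (Ω : Opens (Eu N)) (s p : ℝ) : Set (MeasFun Ω) :=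
  {f | ∀ ε : ℝ≥0∞, 0 < ε → ∃ φ : 𝓓(Ω, ℝ), fracSobolevNorm s p (fun x => zeroExt f x - φ x) < ε}

end FracSuperposition

end

/-!
The norm `‖·‖_μ` averages the seminorms `[·]_{s,p}` over `Σ`. Where `μ` charges a set of parameters,
it dominates every norm which each `[·]_{s,p}` with `(s, p)` in that set controls, with a constant
that may depend on `(s, p)`. In particular it dominates the `L¹` norm of test functions, by the
Sobolev inequalities, so that the inclusion of the test functions into `L¹` extends to the
completion. Injectivity of the extension is the closability of `‖·‖_μ` in `L¹`: the seminorms are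
lower semicontinuous under convergence almost everywhere for `s < 1`, by Fatou's lemma, and weak
gradients are unique for `s = 1`.
-/

open MeasureTheory Set TopologicalSpace
open scoped ENNReal Distributions

noncomputable section

namespace FracSuperposition

open Filter Topology Module
open scoped NNReal

section MeasureTheory

variable {α F : Type*} [MeasurableSpace α] {ν : Measure α} [NormedAddCommGroup F]

/- The constants `C` may depend on `z`; by countable additivity one of them serves on a subset of
`A` of positive measure, where Markov's inequality applies. -/
theorem exists_le_mul_lintegral {ι : Type*} {A : Set α} (hA : ν A ≠ 0) {f : ι → α → ℝ≥0∞}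
    (hf : ∀ i, AEMeasurable (f i) ν) {b : ι → ℝ≥0∞}
    (h : ∀ z ∈ A, ∃ C : ℝ≥0, ∀ i, b i ≤ C * f i z) :
    ∃ C : ℝ≥0, ∀ i, b i ≤ C * ∫⁻ z, f i z ∂ν := by
  let S (k : ℕ) : Set α := {z | ∀ i, b i ≤ k * f i z}
  have hAS : A ⊆ ⋃ k, S k := by
    intro z hz
    obtain ⟨C, hC⟩ := h z hz
    obtain ⟨k, hk⟩ := exists_nat_ge C
    refine mem_iUnion.2 ⟨k, fun i => (hC i).trans ?_⟩
    gcongr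
    exact_mod_cast hk
  obtain ⟨k, hk⟩ : ∃ k, ν (S k) ≠ 0 := by
    by_contra! hS
    exact hA (measure_mono_null hAS (measure_iUnion_null hS))
  set m := min (ν (S k)) 1
  have hm0 : m ≠ 0 := by simp [m, hk]
  have hm : m ≠ ∞ := ne_top_of_le_ne_top ENNReal.one_ne_top (min_le_right _ _)
  have hkm : (k : ℝ≥0∞) / m ≠ ∞ := ENNReal.div_ne_top (by simp) hm0
  refine ⟨(k / m : ℝ≥0∞).toNNReal, fun i => ?_⟩
  rw [ENNReal.coe_toNNReal hkm, ENNReal.mul_comm_div, ← mul_div_assoc,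
    ENNReal.le_div_iff_mul_le (.inl hm0) (.inl hm)]
  calc b i * m ≤ b i * ν {z | b i ≤ k * f i z} := by
        gcongr
        exact (min_le_left _ _).trans (measure_mono fun z hz => hz i)
    _ ≤ ∫⁻ z, k * f i z ∂ν := mul_meas_ge_le_lintegral₀ ((hf i).const_mul _) _
    _ = k * ∫⁻ z, f i z ∂ν := lintegral_const_mul' _ _ (by simp)

theorem exists_eLpNorm_le_of_support_subset {S : Set α} (hS : ν S ≠ ∞) {p q : ℝ≥0∞} (hp : p ≠ 0)
    (hpq : p ≤ q) : ∃ C : ℝ≥0, ∀ f : α → F, AEStronglyMeasurable f ν → Function.support f ⊆ S →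
      eLpNorm f p ν ≤ C * eLpNorm f q ν := by
  have hexp : 1 / q.toReal ≤ 1 / p.toReal := by
    simp only [one_div, ← ENNReal.toReal_inv]
    exact ENNReal.toReal_mono (by simpa) (ENNReal.inv_le_inv.2 hpq)
  have hfin : ν S ^ (1 / p.toReal - 1 / q.toReal) ≠ ∞ :=
    ENNReal.rpow_ne_top_of_nonneg (sub_nonneg.2 hexp) hS
  refine ⟨(ν S ^ (1 / p.toReal - 1 / q.toReal)).toNNReal, fun f hf hfS => ?_⟩
  rw [ENNReal.coe_toNNReal hfin, mul_comm, ← eLpNorm_restrict_eq_of_support_subset hfS,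
    ← eLpNorm_restrict_eq_of_support_subset (p := q) hfS]
  simpa using eLpNorm_le_eLpNorm_mul_rpow_measure_univ hpq (hf.restrict (s := S))

theorem lowerSemicontinuous_Lp {q : ℝ≥0∞} [Fact (1 ≤ q)] {Φ : (α → F) → ℝ≥0∞}
    (hΦ : ∀ (f : ℕ → Lp F q ν) (g : Lp F q ν),
      (∀ᵐ x ∂ν, Tendsto (fun n => f n x) atTop (𝓝 (g x))) →
        Φ g ≤ liminf (fun n => Φ (f n)) atTop) :
    LowerSemicontinuous fun f : Lp F q ν => Φ f := by
  refine lowerSemicontinuous_iff_isClosed_preimage.2 fun y => IsSeqClosed.isClosed ?_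
  intro f g hf hfg
  obtain ⟨ns, -, hns⟩ := (tendstoInMeasure_of_tendsto_Lp hfg).exists_seq_tendsto_ae
  calc Φ g ≤ liminf (fun k => Φ (f (ns k))) atTop := hΦ (fun k => f (ns k)) g hns
    _ ≤ y := liminf_le_of_le (by isBoundedDefault) fun b hb =>
        let ⟨k, hk⟩ := hb.exists; hk.trans (hf (ns k))

theorem lowerSemicontinuous_eLpNorm {q : ℝ≥0∞} [Fact (1 ≤ q)] (r : ℝ≥0∞) :
    LowerSemicontinuous fun f : Lp F q ν => eLpNorm f r ν :=
  lowerSemicontinuous_Lp (Φ := fun f => eLpNorm f r ν) fun f g hfg =>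
    Lp.eLpNorm_lim_le_liminf_eLpNorm (fun n => Lp.aestronglyMeasurable (f n)) g hfg

theorem eLpNorm_ofReal_rpow {p : ℝ} (hp : 0 < p) (f : α → F) :
    eLpNorm f (ENNReal.ofReal p) ν ^ p = ∫⁻ x, ‖f x‖ₑ ^ p ∂ν := by
  have h := eLpNorm_nnreal_pow_eq_lintegral (f := f) (μ := ν) (p := p.toNNReal) (by simpa)
  rwa [Real.coe_toNNReal _ hp.le] at h

end MeasureTheory

/-! ### The Gagliardo energy and the fractional Sobolev inequality -/

section Gagliardo

variable {E F : Type*} [NormedAddCommGroup E] [NormedAddCommGroup F]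

theorem gagliardo_integrand_le {β γ p : ℝ} (hβ : 0 ≤ β) (hβγ : β ≤ γ) (hp : 1 ≤ p) (u : E → F)
    (z : E × E) :
    ENNReal.ofReal (‖u z.1 - u z.2‖ ^ p / ‖z.1 - z.2‖ ^ β) ≤
      ENNReal.ofReal (‖u z.1 - u z.2‖ ^ p / ‖z.1 - z.2‖ ^ γ) +
        2 ^ (p - 1) * (‖u z.1‖ₑ ^ p + ‖u z.2‖ₑ ^ p) *
          ENNReal.ofReal (2 ^ β * (1 + ‖z.1 - z.2‖) ^ (-β)) := by
  have hp0 : 0 < p := one_pos.trans_le hp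
  rcases eq_or_ne z.1 z.2 with hz | hz
  · simp [hz, Real.zero_rpow hp0.ne']
  have hw : 0 < ‖z.1 - z.2‖ := norm_sub_pos_iff.2 hz
  rcases le_total ‖z.1 - z.2‖ 1 with h1 | h1
  · refine le_add_right (ENNReal.ofReal_le_ofReal ?_)
    have hpow := Real.rpow_le_rpow_of_exponent_ge hw h1 hβγ
    gcongr
  refine le_add_left ?_
  have htri : ‖u z.1 - u z.2‖ₑ ^ p ≤ 2 ^ (p - 1) * (‖u z.1‖ₑ ^ p + ‖u z.2‖ₑ ^ p) := calc
    _ ≤ (‖u z.1‖ₑ + ‖u z.2‖ₑ) ^ p := by gcongr; exact enorm_sub_le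
    _ ≤ _ := ENNReal.rpow_add_le_mul_rpow_add_rpow _ _ hp
  have hker : (‖z.1 - z.2‖ ^ β)⁻¹ ≤ 2 ^ β * (1 + ‖z.1 - z.2‖) ^ (-β) := by
    rw [Real.rpow_neg (by positivity), ← div_eq_mul_inv,
      ← Real.div_rpow zero_le_two (by positivity), ← Real.inv_rpow hw.le]
    gcongr
    rw [inv_le_comm₀ hw (by positivity), inv_div, div_le_iff₀ two_pos]
    linarith
  rw [div_eq_mul_inv, ENNReal.ofReal_mul (by positivity),
    ← ENNReal.ofReal_rpow_of_nonneg (norm_nonneg _) hp0.le, ofReal_norm]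
  gcongr

variable [MeasurableSpace E] {ν : Measure E}

/-- The Gagliardo energy `∬ |u(x) - u(y)|^p / |x - y|^β dν(x) dν(y)`. In dimension `d`, smoothness
`s` corresponds to `β = d + s p`. -/
def gagliardoEnergy (ν : Measure E) (β p : ℝ) (u : E → F) : ℝ≥0∞ :=
  ∫⁻ z : E × E, ENNReal.ofReal (‖u z.1 - u z.2‖ ^ p / ‖z.1 - z.2‖ ^ β) ∂(ν.prod ν)

theorem gagliardoEnergy_congr_ae [SFinite ν] {u v : E → F} (h : u =ᵐ[ν] v) (β p : ℝ) :
    gagliardoEnergy ν β p u = gagliardoEnergy ν β p v := by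
  refine lintegral_congr_ae ?_
  filter_upwards [Measure.quasiMeasurePreserving_fst.ae h,
    Measure.quasiMeasurePreserving_snd.ae h] with z h1 h2
  rw [h1, h2]

variable [BorelSpace E]

theorem measurable_gagliardo_integrand [SecondCountableTopology E] {u : E → F}
    (hu : StronglyMeasurable u) (β p : ℝ) :
    Measurable fun z : E × E => ENNReal.ofReal (‖u z.1 - u z.2‖ ^ p / ‖z.1 - z.2‖ ^ β) := by
  have hdiff := (hu.comp_measurable measurable_fst).sub (hu.comp_measurable measurable_snd)
  have hnorm : Measurable fun z : E × E => ‖u z.1 - u z.2‖ := hdiff.norm.measurable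
  fun_prop

theorem lowerSemicontinuous_gagliardoEnergy [SecondCountableTopology E] [SFinite ν]
    {q : ℝ≥0∞} [Fact (1 ≤ q)] (β : ℝ) {p : ℝ} (hp : 0 ≤ p) :
    LowerSemicontinuous fun f : Lp F q ν => gagliardoEnergy ν β p f := by
  refine lowerSemicontinuous_Lp (Φ := gagliardoEnergy ν β p) fun f g hfg => ?_
  have hlim : ∀ᵐ z ∂(ν.prod ν), Tendsto
      (fun n => ENNReal.ofReal (‖f n z.1 - f n z.2‖ ^ p / ‖z.1 - z.2‖ ^ β)) atTop
      (𝓝 (ENNReal.ofReal (‖g z.1 - g z.2‖ ^ p / ‖z.1 - z.2‖ ^ β))) := by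
    filter_upwards [Measure.quasiMeasurePreserving_fst.ae hfg,
      Measure.quasiMeasurePreserving_snd.ae hfg] with z h1 h2
    exact ENNReal.tendsto_ofReal (((h1.sub h2).norm.rpow_const (.inr hp)).div_const _)
  calc gagliardoEnergy ν β p g
      = ∫⁻ z, liminf (fun n => ENNReal.ofReal
          (‖f n z.1 - f n z.2‖ ^ p / ‖z.1 - z.2‖ ^ β)) atTop ∂(ν.prod ν) :=
        lintegral_congr_ae (hlim.mono fun z hz => hz.liminf_eq.symm)
    _ ≤ liminf (fun n => gagliardoEnergy ν β p (f n)) atTop :=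
        lintegral_liminf_le fun n => measurable_gagliardo_integrand (Lp.stronglyMeasurable _) β p

variable [NormedSpace ℝ E] [FiniteDimensional ℝ E] [ν.IsAddHaarMeasure]

theorem lintegral_prod_fst_mul_comp_sub {f g : E → ℝ≥0∞} (hf : Measurable f) (hg : Measurable g) :
    ∫⁻ z : E × E, f z.1 * g (z.1 - z.2) ∂(ν.prod ν) = (∫⁻ x, f x ∂ν) * ∫⁻ w, g w ∂ν := by
  rw [lintegral_prod _ (by fun_prop), ← lintegral_mul_const _ hf]
  refine lintegral_congr fun x => ?_
  dsimp only
  rw [lintegral_const_mul _ (by fun_prop), lintegral_sub_left_eq_self g x]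

theorem lintegral_prod_snd_mul_comp_sub {f g : E → ℝ≥0∞} (hf : Measurable f) (hg : Measurable g) :
    ∫⁻ z : E × E, f z.2 * g (z.1 - z.2) ∂(ν.prod ν) = (∫⁻ x, f x ∂ν) * ∫⁻ w, g w ∂ν := by
  rw [lintegral_prod_symm _ (by fun_prop), ← lintegral_mul_const _ hf]
  refine lintegral_congr fun y => ?_
  dsimp only
  rw [lintegral_const_mul _ (by fun_prop), lintegral_sub_right_eq_self g y]

theorem exists_gagliardoEnergy_le {β γ p : ℝ} (hβ : finrank ℝ E < β) (hβγ : β ≤ γ) (hp : 1 ≤ p) :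
    ∃ C : ℝ≥0, ∀ u : E → F, StronglyMeasurable u →
      gagliardoEnergy ν β p u ≤
        gagliardoEnergy ν γ p u + C * eLpNorm u (ENNReal.ofReal p) ν ^ p := by
  set K : E → ℝ≥0∞ := fun w => ENNReal.ofReal (2 ^ β * (1 + ‖w‖) ^ (-β)) with hK
  have hKm : Measurable K := by fun_prop
  have hKfin : ∫⁻ w, K w ∂ν ≠ ∞ := by
    simp only [hK, ENNReal.ofReal_mul (show (0 : ℝ) ≤ 2 ^ β by positivity)]
    rw [lintegral_const_mul' _ _ ENNReal.ofReal_ne_top]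
    exact ENNReal.mul_ne_top ENNReal.ofReal_ne_top (finite_integral_one_add_norm hβ).ne
  have hC : (2 : ℝ≥0∞) ^ (p - 1) * (2 * ∫⁻ w, K w ∂ν) ≠ ∞ :=
    ENNReal.mul_ne_top (ENNReal.rpow_ne_top_of_nonneg (by linarith) (by simp))
      (ENNReal.mul_ne_top (by simp) hKfin)
  refine ⟨((2 : ℝ≥0∞) ^ (p - 1) * (2 * ∫⁻ w, K w ∂ν)).toNNReal, fun u hu => ?_⟩
  have hum : Measurable fun x => ‖u x‖ₑ ^ p := hu.enorm.pow_const p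
  calc gagliardoEnergy ν β p u
      ≤ ∫⁻ z : E × E, (ENNReal.ofReal (‖u z.1 - u z.2‖ ^ p / ‖z.1 - z.2‖ ^ γ) +
          2 ^ (p - 1) * (‖u z.1‖ₑ ^ p + ‖u z.2‖ₑ ^ p) * K (z.1 - z.2)) ∂(ν.prod ν) :=
        lintegral_mono fun z =>
          gagliardo_integrand_le ((Nat.cast_nonneg _).trans hβ.le) hβγ hp u z
    _ = gagliardoEnergy ν γ p u + 2 ^ (p - 1) * ((∫⁻ x, ‖u x‖ₑ ^ p ∂ν) * (∫⁻ w, K w ∂ν) +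
          (∫⁻ x, ‖u x‖ₑ ^ p ∂ν) * ∫⁻ w, K w ∂ν) := by
        rw [lintegral_add_left (measurable_gagliardo_integrand hu γ p)]
        simp only [mul_assoc]
        rw [lintegral_const_mul _ (by fun_prop)]
        simp only [add_mul]
        rw [lintegral_add_left (by fun_prop), lintegral_prod_fst_mul_comp_sub hum hKm,
          lintegral_prod_snd_mul_comp_sub hum hKm, gagliardoEnergy]
    _ = _ := by
        rw [eLpNorm_ofReal_rpow (one_pos.trans_le hp), ENNReal.coe_toNNReal hC]
        ring

/-- The Sobolev conjugate `d p / (d - s p)` of `p` in dimension `d`, for smoothness `s`. -/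
def critExp (d s p : ℝ) : ℝ := d * p / (d - s * p)

theorem le_critExp {d s p : ℝ} (hs : 0 ≤ s) (hp : 0 ≤ p) (hsp : s * p < d) :
    p ≤ critExp d s p := by
  rw [critExp, le_div_iff₀ (sub_pos.2 hsp)]
  nlinarith [mul_nonneg hs (mul_nonneg hp hp)]

theorem add_critExp_mul {d s p : ℝ} (hd : d ≠ 0) (hsp : s * p ≠ d) :
    p + critExp d s p * (s * p / d) = critExp d s p := by
  have h : critExp d s p * (d - s * p) = d * p := div_mul_cancel₀ _ (sub_ne_zero.2 hsp.symm)
  field_simp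
  linarith

theorem critExp_le_critExp {d s p s' p' : ℝ} (hs : 0 ≤ s) (hss' : s ≤ s') (hp : 0 ≤ p)
    (hpp' : p ≤ p') (h : s' * p' < d) : critExp d s p ≤ critExp d s' p' := by
  have hsp : s * p ≤ s' * p' := mul_le_mul hss' hpp' hp (hs.trans hss')
  have hd : 0 ≤ d := (mul_nonneg (hs.trans hss') (hp.trans hpp')).trans h.le
  have : 0 < d - s' * p' := sub_pos.2 h
  have hdp' : 0 ≤ d * p' := mul_nonneg hd (hp.trans hpp')
  unfold critExp
  gcongr

theorem inv_rpow_mul_half_measure_ball_le_lintegral {α : Type*} [PseudoMetricSpace α]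
    [MeasurableSpace α] [OpensMeasurableSpace α] {ν : Measure α} {S : Set α}
    (hSm : MeasurableSet S) {x : α} {r β : ℝ} (hβ : 0 ≤ β)
    (hfin : ν (Metric.ball x r) ≠ ∞) (hS : ν S ≤ ν (Metric.ball x r) / 2) :
    (ENNReal.ofReal r ^ β)⁻¹ * (ν (Metric.ball x r) / 2) ≤
      ∫⁻ y in Sᶜ, (edist x y ^ β)⁻¹ ∂ν := by
  set B := Metric.ball x r
  have hBS : ν B / 2 ≤ ν (B \ S) := calc
    ν B / 2 = ν B - ν B / 2 := (ENNReal.sub_half hfin).symm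
    _ ≤ ν B - ν S := by gcongr
    _ ≤ ν (B \ S) := le_measure_sdiff
  calc (ENNReal.ofReal r ^ β)⁻¹ * (ν B / 2) ≤ (ENNReal.ofReal r ^ β)⁻¹ * ν (B \ S) := by gcongr
    _ = ∫⁻ _ in B \ S, (ENNReal.ofReal r ^ β)⁻¹ ∂ν := (setLIntegral_const _ _).symm
    _ ≤ ∫⁻ y in B \ S, (edist x y ^ β)⁻¹ ∂ν := by
      refine setLIntegral_mono' (Metric.isOpen_ball.measurableSet.diff hSm) fun y hy => ?_
      gcongr
      rw [edist_dist, dist_comm]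
      exact ENNReal.ofReal_le_ofReal (Metric.mem_ball.1 hy.1).le
    _ ≤ ∫⁻ y in Sᶜ, (edist x y ^ β)⁻¹ ∂ν := lintegral_mono_set fun y hy => hy.2

/- Half of a ball of measure `2 m` around `x` lies off `S`. -/
theorem le_lintegral_compl_of_measure_le [Nontrivial E] {S : Set E} (hSm : MeasurableSet S) {m : ℝ}
    (hm : 0 < m) (hS : ν S ≤ ENNReal.ofReal m) {t : ℝ} (ht : 0 ≤ t) (x : E) :
    ENNReal.ofReal ((ν.real (Metric.ball 0 1) / 2) ^ (1 + t) * m ^ (-t)) ≤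
      ∫⁻ y in Sᶜ, (edist x y ^ (finrank ℝ E * (1 + t)))⁻¹ ∂ν := by
  set ω := ν.real (Metric.ball (0 : E) 1)
  have hω : 0 < ω := ENNReal.toReal_pos (Metric.measure_ball_pos ν 0 one_pos).ne'
    Metric.isBounded_ball.measure_lt_top.ne
  have hd : (0 : ℝ) < finrank ℝ E := by exact_mod_cast finrank_pos (R := ℝ) (M := E)
  set r := (m / (ω / 2)) ^ (finrank ℝ E : ℝ)⁻¹
  have hr : 0 < r := by positivity
  have hrd : r ^ (finrank ℝ E : ℝ) = m / (ω / 2) := Real.rpow_inv_rpow (by positivity) hd.ne'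
  have hball : ν (Metric.ball x r) = ENNReal.ofReal (2 * m) := by
    rw [Measure.addHaar_ball_of_pos _ _ hr,
      ← ofReal_measureReal Metric.isBounded_ball.measure_lt_top.ne,
      ← ENNReal.ofReal_mul (by positivity), ← Real.rpow_natCast, hrd]
    congr 1
    change m / (ω / 2) * ω = _
    field_simp
  have hhalf : ν (Metric.ball x r) / 2 = ENNReal.ofReal m := by
    rw [hball, ENNReal.ofReal_mul zero_le_two, ENNReal.ofReal_ofNat, mul_comm]
    exact ENNReal.mul_div_cancel_right (by simp) (by simp)
  have hconst : (ω / 2) ^ (1 + t) * m ^ (-t) = (r ^ (finrank ℝ E * (1 + t)))⁻¹ * m := by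
    rw [Real.rpow_mul hr.le, hrd, Real.div_rpow hm.le (by positivity), inv_div,
      Real.rpow_add hm, Real.rpow_one, Real.rpow_neg hm.le]
    field_simp
  rw [hconst, ENNReal.ofReal_mul (by positivity), ENNReal.ofReal_inv_of_pos (by positivity),
    ← ENNReal.ofReal_rpow_of_pos hr, ← hhalf]
  exact inv_rpow_mul_half_measure_ball_le_lintegral hSm (by positivity)
    (by rw [hball]; exact ENNReal.ofReal_ne_top) (by rwa [hhalf])

/- By Markov's inequality the set where `‖u y‖ ≥ ‖u x‖ / 2` has small measure; off this set
`‖u x - u y‖ ≥ ‖u x‖ / 2`. -/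
theorem le_lintegral_gagliardo_slice [Nontrivial E] {u : E → F} (hu : StronglyMeasurable u)
    {p q t n : ℝ} (hp : 0 ≤ p) (hq : 0 < q) (ht : 0 ≤ t) (hn : 0 < n)
    (hun : eLpNorm u (ENNReal.ofReal q) ν = ENNReal.ofReal n) {x : E} (hx : u x ≠ 0) :
    ENNReal.ofReal ((ν.real (Metric.ball 0 1) / 2) ^ (1 + t) * n ^ (-(q * t)) *
        (‖u x‖ / 2) ^ (p + q * t)) ≤
      ∫⁻ y, ENNReal.ofReal (‖u x - u y‖ ^ p / ‖x - y‖ ^ (finrank ℝ E * (1 + t))) ∂ν := by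
  set a := ‖u x‖ / 2
  have ha : 0 < a := half_pos (norm_pos_iff.2 hx)
  set S := {y | ENNReal.ofReal a ≤ ‖u y‖ₑ}
  have hSm : MeasurableSet S := measurableSet_le measurable_const hu.enorm
  have hS : ν S ≤ ENNReal.ofReal ((a⁻¹ * n) ^ q) := by
    rw [Real.mul_rpow (by positivity) hn.le, ENNReal.ofReal_mul (by positivity),
      ← ENNReal.ofReal_rpow_of_pos hn, ← ENNReal.ofReal_rpow_of_pos (inv_pos.2 ha),
      ENNReal.ofReal_inv_of_pos ha, ← hun]
    simpa only [ENNReal.toReal_ofReal hq.le] using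
      meas_ge_le_mul_pow_eLpNorm_enorm ν (p := ENNReal.ofReal q) (ε := ENNReal.ofReal a)
        (by simpa) ENNReal.ofReal_ne_top hu.aestronglyMeasurable (by simpa) (by simp)
  have hslice (y : E) (hy : y ∈ Sᶜ) : ENNReal.ofReal (a ^ p) *
      (edist x y ^ (finrank ℝ E * (1 + t)))⁻¹ ≤
        ENNReal.ofReal (‖u x - u y‖ ^ p / ‖x - y‖ ^ (finrank ℝ E * (1 + t))) := by
    have huy : ‖u y‖ < a := by
      rwa [mem_compl_iff, mem_ofPred_eq, not_le, ← ofReal_norm,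
        ENNReal.ofReal_lt_ofReal_iff ha] at hy
    have hxy : 0 < ‖x - y‖ := norm_sub_pos_iff.2 fun h => by
      rw [← h] at huy; linarith [norm_nonneg (u x), show a = ‖u x‖ / 2 from rfl]
    have hdiff : a ≤ ‖u x - u y‖ := by
      linarith [norm_sub_norm_le (u x) (u y), show a = ‖u x‖ / 2 from rfl]
    rw [edist_eq_enorm_sub, ← ofReal_norm, ENNReal.ofReal_rpow_of_pos hxy,
      ENNReal.ofReal_div_of_pos (by positivity), div_eq_mul_inv]
    gcongr
  have hconst : (ν.real (Metric.ball (0 : E) 1) / 2) ^ (1 + t) * n ^ (-(q * t)) * a ^ (p + q * t) =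
      a ^ p * ((ν.real (Metric.ball (0 : E) 1) / 2) ^ (1 + t) * ((a⁻¹ * n) ^ q) ^ (-t)) := by
    rw [← Real.rpow_mul (by positivity), Real.mul_rpow (by positivity) hn.le, mul_neg,
      Real.rpow_neg (inv_pos.2 ha).le, Real.inv_rpow ha.le, inv_inv, Real.rpow_add ha]
    ring
  calc _ ≤ ENNReal.ofReal (a ^ p) * ∫⁻ y in Sᶜ, (edist x y ^ (finrank ℝ E * (1 + t)))⁻¹ ∂ν := by
        rw [hconst, ENNReal.ofReal_mul (by positivity)]
        gcongr
        exact le_lintegral_compl_of_measure_le hSm (by positivity) hS ht x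
    _ = ∫⁻ y in Sᶜ, ENNReal.ofReal (a ^ p) * (edist x y ^ (finrank ℝ E * (1 + t)))⁻¹ ∂ν :=
        (lintegral_const_mul' _ _ ENNReal.ofReal_ne_top).symm
    _ ≤ _ := (setLIntegral_mono' hSm.compl hslice).trans (setLIntegral_le_lintegral _ _)

theorem mul_eLpNorm_rpow_le_gagliardoEnergy [Nontrivial E] {u : E → F} (hu : StronglyMeasurable u)
    {p q t : ℝ} (hp : 0 < p) (hq : 0 < q) (ht : 0 ≤ t) (hpq : p + q * t = q)
    (hfin : eLpNorm u (ENNReal.ofReal q) ν ≠ ∞) :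
    ENNReal.ofReal ((ν.real (Metric.ball 0 1) / 2) ^ (1 + t) * (2 ^ q)⁻¹) *
      eLpNorm u (ENNReal.ofReal q) ν ^ p ≤ gagliardoEnergy ν (finrank ℝ E * (1 + t)) p u := by
  set c := (ν.real (Metric.ball (0 : E) 1) / 2) ^ (1 + t)
  have : 0 ≤ c := by positivity
  rcases eq_or_ne (eLpNorm u (ENNReal.ofReal q) ν) 0 with h0 | h0
  · simp [h0, hp]
  set n := (eLpNorm u (ENNReal.ofReal q) ν).toReal
  have hn : 0 < n := ENNReal.toReal_pos h0 hfin
  have hun : eLpNorm u (ENNReal.ofReal q) ν = ENNReal.ofReal n := (ENNReal.ofReal_toReal hfin).symm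
  have hconst : c * (2 ^ q)⁻¹ * n ^ p = c * n ^ (-(q * t)) * (2 ^ q)⁻¹ * n ^ q := by
    rw [show p = -(q * t) + q by linarith, Real.rpow_add hn]
    ring
  have hslice (x : E) :
      ENNReal.ofReal (c * n ^ (-(q * t)) * (2 ^ q)⁻¹) * ‖u x‖ₑ ^ q ≤
        ∫⁻ y, ENNReal.ofReal (‖u x - u y‖ ^ p / ‖x - y‖ ^ (finrank ℝ E * (1 + t))) ∂ν := by
    rcases eq_or_ne (u x) 0 with hx | hx
    · simp [hx, hq]
    convert le_lintegral_gagliardo_slice hu hp.le hq ht hn hun hx using 1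
    rw [← ofReal_norm, ENNReal.ofReal_rpow_of_nonneg (norm_nonneg _) hq.le,
      ← ENNReal.ofReal_mul (by positivity), hpq, Real.div_rpow (norm_nonneg _) zero_le_two]
    congr 1
    ring
  calc ENNReal.ofReal (c * (2 ^ q)⁻¹) * eLpNorm u (ENNReal.ofReal q) ν ^ p
      = ENNReal.ofReal (c * n ^ (-(q * t)) * (2 ^ q)⁻¹) *
          eLpNorm u (ENNReal.ofReal q) ν ^ q := by
        rw [hun, ENNReal.ofReal_rpow_of_pos hn, ENNReal.ofReal_rpow_of_pos hn,
          ← ENNReal.ofReal_mul (by positivity), ← ENNReal.ofReal_mul (by positivity), hconst]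
    _ = ∫⁻ x, ENNReal.ofReal (c * n ^ (-(q * t)) * (2 ^ q)⁻¹) * ‖u x‖ₑ ^ q ∂ν := by
        rw [eLpNorm_ofReal_rpow hq, lintegral_const_mul' _ _ ENNReal.ofReal_ne_top]
    _ ≤ ∫⁻ x, ∫⁻ y, ENNReal.ofReal
          (‖u x - u y‖ ^ p / ‖x - y‖ ^ (finrank ℝ E * (1 + t))) ∂ν ∂ν := lintegral_mono hslice
    _ = gagliardoEnergy ν (finrank ℝ E * (1 + t)) p u :=
        (lintegral_prod _ (measurable_gagliardo_integrand hu _ _).aemeasurable).symm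

theorem exists_eLpNorm_critExp_rpow_le_gagliardoEnergy {s p : ℝ} (hs : 0 < s) (hp : 0 < p)
    (hsp : s * p < finrank ℝ E) : ∃ C : ℝ≥0, ∀ u : E → F, StronglyMeasurable u →
      eLpNorm u (ENNReal.ofReal (critExp (finrank ℝ E) s p)) ν ≠ ∞ →
      eLpNorm u (ENNReal.ofReal (critExp (finrank ℝ E) s p)) ν ^ p ≤
        C * gagliardoEnergy ν (finrank ℝ E + s * p) p u := by
  have hd : (0 : ℝ) < finrank ℝ E := (mul_pos hs hp).trans hsp
  have : Nontrivial E := nontrivial_of_finrank_pos (R := ℝ) (by exact_mod_cast hd)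
  set q := critExp (finrank ℝ E) s p
  have hq : 0 < q := hp.trans_le (le_critExp hs.le hp.le hsp)
  set t := s * p / finrank ℝ E with ht_def
  have hpq : p + q * t = q := add_critExp_mul hd.ne' hsp.ne
  have hβ : finrank ℝ E * (1 + t) = finrank ℝ E + s * p := by rw [ht_def]; field_simp
  set c := (ν.real (Metric.ball (0 : E) 1) / 2) ^ (1 + t) * (2 ^ q)⁻¹
  have hω : 0 < ν.real (Metric.ball (0 : E) 1) := ENNReal.toReal_pos
    (Metric.measure_ball_pos ν 0 one_pos).ne' Metric.isBounded_ball.measure_lt_top.ne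
  have hc : 0 < c := by positivity
  refine ⟨c⁻¹.toNNReal, fun u hu hfin => ?_⟩
  change _ ≤ ENNReal.ofReal c⁻¹ * _
  rw [ENNReal.ofReal_inv_of_pos hc, ← hβ, mul_comm, ← div_eq_mul_inv,
    ENNReal.le_div_iff_mul_le (by simp [hc]) (by simp), mul_comm]
  exact mul_eLpNorm_rpow_le_gagliardoEnergy hu hp hq (by positivity) hpq hfin

end Gagliardo

section Euclidean

variable {N : ℕ}

theorem fracConst_pos (hN : 1 ≤ N) {s p : ℝ} (hs0 : 0 < s) (hs1 : s < 1) (hp : 1 < p) :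
    0 < fracConst N s p := by
  have hN' : (1 : ℝ) ≤ N := by exact_mod_cast hN
  have hps : 0 < p * s := by positivity
  have : 0 < Real.Gamma ((p * s + p + N - 2) / 2) := Real.Gamma_pos_of_pos (by linarith)
  have : 0 < Real.Gamma (1 - s) := Real.Gamma_pos_of_pos (by linarith)
  unfold fracConst
  positivity

theorem gagliardo_eq (s p : ℝ) (u : Eu N → ℝ) :
    gagliardo N s p u =
      (ENNReal.ofReal (fracConst N s p) * gagliardoEnergy volume (N + s * p) p u) ^ (1 / p) :=
  rfl

theorem gagliardo_congr_ae {u v : Eu N → ℝ} (h : u =ᵐ[volume] v) (s p : ℝ) :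
    gagliardo N s p u = gagliardo N s p v := by
  rw [gagliardo_eq, gagliardo_eq, gagliardoEnergy_congr_ae h]

theorem lowerSemicontinuous_gagliardo {q : ℝ≥0∞} [Fact (1 ≤ q)] (s : ℝ) {p : ℝ} (hp : 0 ≤ p) :
    LowerSemicontinuous fun f : Lp ℝ q (volume : Measure (Eu N)) => gagliardo N s p f := by
  have hcont : Continuous fun x : ℝ≥0∞ => (ENNReal.ofReal (fracConst N s p) * x) ^ (1 / p) :=
    ENNReal.continuous_rpow_const.comp (ENNReal.continuous_const_mul ENNReal.ofReal_ne_top)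
  have hmono : Monotone fun x : ℝ≥0∞ => (ENNReal.ofReal (fracConst N s p) * x) ^ (1 / p) :=
    fun x y hxy => by dsimp only; gcongr
  exact hcont.comp_lowerSemicontinuous (lowerSemicontinuous_gagliardoEnergy (N + s * p) hp) hmono

theorem exists_eLpNorm_critExp_le_gagliardo {s p : ℝ} (hs0 : 0 < s) (hs1 : s < 1) (hp : 1 < p)
    (hsp : s * p < N) : ∃ C : ℝ≥0, ∀ u : Eu N → ℝ, StronglyMeasurable u →
      eLpNorm u (ENNReal.ofReal (critExp N s p)) volume ≠ ∞ →
      eLpNorm u (ENNReal.ofReal (critExp N s p)) volume ≤ C * gagliardo N s p u := by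
  have hp0 : 0 < p := one_pos.trans hp
  have hN : 1 ≤ N := by
    have hN0 : (0 : ℝ) < N := (mul_pos hs0 hp0).trans hsp
    exact_mod_cast hN0
  have hc := fracConst_pos hN hs0 hs1 hp
  obtain ⟨C, hC⟩ := exists_eLpNorm_critExp_rpow_le_gagliardoEnergy (E := Eu N) (F := ℝ)
    (ν := volume) hs0 hp0 (by rwa [finrank_euclideanSpace_fin])
  simp only [finrank_euclideanSpace_fin] at hC
  refine ⟨(C / (fracConst N s p).toNNReal) ^ (1 / p), fun u hu hfin => ?_⟩
  rw [gagliardo_eq, ENNReal.coe_rpow_of_nonneg _ (by positivity),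
    ← ENNReal.mul_rpow_of_nonneg _ _ (by positivity),
    one_div, ENNReal.le_rpow_inv_iff hp0, ENNReal.coe_div (by simpa), ← mul_assoc]
  rw [show ((fracConst N s p).toNNReal : ℝ≥0∞) = ENNReal.ofReal (fracConst N s p) from rfl,
    ENNReal.div_mul_cancel (by simpa) ENNReal.ofReal_ne_top]
  exact hC u hu hfin

theorem exists_gagliardo_le {s σ p : ℝ} (hN : 1 ≤ N) (hs0 : 0 < s) (hsσ : s ≤ σ) (hσ1 : σ < 1)
    (hp : 1 < p) : ∃ C : ℝ≥0, ∀ u : Eu N → ℝ, StronglyMeasurable u →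
      gagliardo N s p u ≤ C * (gagliardo N σ p u + eLpNorm u (ENNReal.ofReal p) volume) := by
  have hp0 : 0 < p := one_pos.trans hp
  set c := ENNReal.ofReal (fracConst N s p)
  set c' := ENNReal.ofReal (fracConst N σ p)
  have hc' : c' ≠ 0 := by simpa [c'] using fracConst_pos hN (hs0.trans_le hsσ) hσ1 hp
  obtain ⟨C, hC⟩ := exists_gagliardoEnergy_le (E := Eu N) (F := ℝ) (ν := volume)
    (β := N + s * p) (γ := N + σ * p) (p := p)
    (by rw [finrank_euclideanSpace_fin]; linarith [mul_pos hs0 hp0]) (by gcongr) hp.le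
  have hD : (max (c / c') (c * C)) ^ (1 / p) ≠ ∞ :=
    ENNReal.rpow_ne_top_of_nonneg (by positivity) <| max_ne_top
      (ENNReal.div_ne_top ENNReal.ofReal_ne_top hc')
      (ENNReal.mul_ne_top ENNReal.ofReal_ne_top ENNReal.coe_ne_top)
  refine ⟨((max (c / c') (c * C)) ^ (1 / p)).toNNReal, fun u hu => ?_⟩
  rw [ENNReal.coe_toNNReal hD]
  set D := max (c / c') (c * C)
  set L := eLpNorm u (ENNReal.ofReal p) volume
  calc gagliardo N s p u
      ≤ (c * (gagliardoEnergy volume (N + σ * p) p u + C * L ^ p)) ^ (1 / p) := by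
        rw [gagliardo_eq]
        gcongr
        exact hC u hu
    _ = (c / c' * (c' * gagliardoEnergy volume (N + σ * p) p u) + c * C * L ^ p) ^ (1 / p) := by
        rw [← mul_assoc, ENNReal.div_mul_cancel hc' ENNReal.ofReal_ne_top]
        ring_nf
    _ ≤ (D * (c' * gagliardoEnergy volume (N + σ * p) p u) + D * L ^ p) ^ (1 / p) := by
        gcongr
        exacts [le_max_left _ _, le_max_right _ _]
    _ = D ^ (1 / p) * (c' * gagliardoEnergy volume (N + σ * p) p u + L ^ p) ^ (1 / p) := by
        rw [← mul_add, ENNReal.mul_rpow_of_nonneg _ _ (by positivity)]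
    _ ≤ D ^ (1 / p) * (gagliardo N σ p u + L) := by
        gcongr
        refine (ENNReal.rpow_add_le_add_rpow _ _ (by positivity)
          ((div_le_one hp0).2 hp.le)).trans_eq ?_
        rw [← ENNReal.rpow_mul, mul_one_div_cancel hp0.ne', ENNReal.rpow_one, gagliardo_eq]

end Euclidean

/-! ### Test functions -/

section TestFunctions

variable {N : ℕ} {Ω : Opens (Eu N)}

theorem support_subset (φ : 𝓓(Ω, ℝ)) : Function.support φ ⊆ (Ω : Set (Eu N)) :=
  (subset_tsupport _).trans φ.tsupport_subset

theorem support_gradient_subset_tsupport (u : Eu N → ℝ) :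
    Function.support (gradient u) ⊆ tsupport u := fun x hx =>
  support_fderiv_subset ℝ fun h => hx (by simp [gradient, h])

theorem support_gradient_subset (φ : 𝓓(Ω, ℝ)) :
    Function.support (gradient φ) ⊆ (Ω : Set (Eu N)) :=
  (support_gradient_subset_tsupport φ).trans φ.tsupport_subset

theorem memLp_testFunction (φ : 𝓓(Ω, ℝ)) (p : ℝ≥0∞) : MemLp φ p volume :=
  φ.continuous.memLp_of_hasCompactSupport φ.hasCompactSupport

theorem memLp_gradient (φ : 𝓓(Ω, ℝ)) (p : ℝ≥0∞) : MemLp (gradient φ) p volume :=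
  (continuous_gradient φ).memLp_of_hasCompactSupport
    (φ.hasCompactSupport.mono' (support_gradient_subset_tsupport φ))

theorem sobolev_gradient {p : ℝ} (hp1 : 1 < p) (hpN : p < N) :
    ∃ C : ℝ≥0, ∀ φ : 𝓓(Ω, ℝ), eLpNorm φ (ENNReal.ofReal (critExp N 1 p)) volume ≤
      C * eLpNorm (gradient φ) (ENNReal.ofReal p) volume := by
  have hp0 : 0 < p := one_pos.trans hp1
  have hq : 0 ≤ critExp N 1 p := hp0.le.trans (le_critExp zero_le_one hp0.le (by rwa [one_mul]))
  have hN : 0 < N := by exact_mod_cast hp0.trans hpN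
  refine ⟨SNormLESNormFDerivOfEqConst ℝ (volume : Measure (Eu N)) p.toNNReal, fun φ => ?_⟩
  have hgrad : eLpNorm (gradient φ) (ENNReal.ofReal p) volume =
      eLpNorm (fderiv ℝ φ) (ENNReal.ofReal p) volume :=
    eLpNorm_congr_norm_ae (ae_of_all _ fun x => norm_gradient φ x)
  rw [hgrad]
  refine eLpNorm_le_eLpNorm_fderiv_of_eq volume (contDiff_one φ) φ.hasCompactSupport
    (p := p.toNNReal) (p' := (critExp N 1 p).toNNReal) (by simpa using hp1.le)
    (by simpa using hN) ?_
  rw [Real.coe_toNNReal _ hq, NNReal.coe_inv, Real.coe_toNNReal _ hp0.le,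
    finrank_euclideanSpace_fin, critExp]
  have : (N : ℝ) - p ≠ 0 := (sub_pos.2 hpN).ne'
  field_simp

theorem mul_lt_of_mem_Sig {z : ℝ × ℝ} (hz : z ∈ Sig N) : z.1 * z.2 < N :=
  (mul_le_of_le_one_left (one_pos.trans hz.2.1).le hz.1.2).trans_lt hz.2.2

theorem sobolev_semi {z : ℝ × ℝ} (hz : z ∈ Sig N) :
    ∃ C : ℝ≥0, ∀ φ : 𝓓(Ω, ℝ), eLpNorm φ (ENNReal.ofReal (critExp N z.1 z.2)) volume ≤
      C * semi N z.1 z.2 φ := by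
  have hsp := mul_lt_of_mem_Sig hz
  obtain ⟨s, p⟩ := z
  obtain ⟨⟨hs0, hs1⟩, hp1, hpN⟩ := hz
  dsimp only at hs0 hs1 hp1 hpN hsp ⊢
  unfold semi
  split_ifs with h0 h1
  · have hN : (N : ℝ) ≠ 0 := (one_pos.trans (hp1.trans hpN)).ne'
    exact ⟨1, fun φ => by simp [h0, critExp, hN]⟩
  · exact h1 ▸ sobolev_gradient hp1 hpN
  · obtain ⟨C, hC⟩ := exists_eLpNorm_critExp_le_gagliardo (lt_of_le_of_ne' hs0 h0)
      (lt_of_le_of_ne hs1 h1) hp1 hsp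
    exact ⟨C, fun φ => hC φ φ.continuous.stronglyMeasurable
      (memLp_testFunction φ _).eLpNorm_ne_top⟩

end TestFunctions

section Control

variable {N : ℕ} {Ω : Opens (Eu N)} {μ : Measure (ℝ × ℝ)} {A : Set (ℝ × ℝ)}

theorem exists_le_muNorm (hAS : A ⊆ Sig N) (hA : μ A ≠ 0) {G : 𝓓(Ω, ℝ) → ℝ≥0∞}
    (h : ∀ z ∈ A, ∃ C : ℝ≥0, ∀ φ : 𝓓(Ω, ℝ), G φ ≤ C * semi N z.1 z.2 φ) :
    ∃ C : ℝ≥0, ∀ φ : 𝓓(Ω, ℝ), G φ ≤ C * muNorm μ φ :=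
  exists_le_mul_lintegral (ν := μ.restrict (Sig N)) (by rwa [Measure.restrict_eq_self μ hAS])
    (aemeasurable_semi μ) h

theorem exists_eLpNorm_le_semi (hΩ : volume (Ω : Set (Eu N)) ≠ ∞) {z : ℝ × ℝ} (hz : z ∈ Sig N)
    {q : ℝ≥0∞} (hq : q ≠ 0) (hqz : q ≤ ENNReal.ofReal (critExp N z.1 z.2)) :
    ∃ C : ℝ≥0, ∀ φ : 𝓓(Ω, ℝ), eLpNorm φ q volume ≤ C * semi N z.1 z.2 φ := by
  obtain ⟨C₁, hC₁⟩ := exists_eLpNorm_le_of_support_subset (F := ℝ) hΩ hq hqz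
  obtain ⟨C₂, hC₂⟩ := sobolev_semi (Ω := Ω) hz
  refine ⟨C₁ * C₂, fun φ => ?_⟩
  calc eLpNorm φ q volume
      ≤ C₁ * eLpNorm φ (ENNReal.ofReal (critExp N z.1 z.2)) volume :=
        hC₁ φ φ.continuous.aestronglyMeasurable (support_subset φ)
    _ ≤ C₁ * (C₂ * semi N z.1 z.2 φ) := by gcongr; exact hC₂ φ
    _ = (C₁ * C₂ : ℝ≥0) * semi N z.1 z.2 φ := by push_cast; ring

theorem exists_eLpNorm_le_muNorm (hΩ : volume (Ω : Set (Eu N)) ≠ ∞) (hAS : A ⊆ Sig N)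
    (hA : μ A ≠ 0) {q : ℝ≥0∞} (hq : q ≠ 0)
    (hqA : ∀ z ∈ A, q ≤ ENNReal.ofReal (critExp N z.1 z.2)) :
    ∃ C : ℝ≥0, ∀ φ : 𝓓(Ω, ℝ), eLpNorm φ q volume ≤ C * muNorm μ φ :=
  exists_le_muNorm hAS hA fun z hz => exists_eLpNorm_le_semi hΩ (hAS hz) hq (hqA z hz)

theorem exists_eLpNorm_gradient_le_muNorm (hΩ : volume (Ω : Set (Eu N)) ≠ ∞) {p : ℝ} (hp : 1 < p)
    (hμ : μ ({1} ×ˢ Ico p N) ≠ 0) : ∃ C : ℝ≥0, ∀ φ : 𝓓(Ω, ℝ),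
      eLpNorm (gradient φ) (ENNReal.ofReal p) volume ≤ C * muNorm μ φ := by
  have hAS : ({1} ×ˢ Ico p N : Set (ℝ × ℝ)) ⊆ Sig N :=
    prod_mono (by simp) fun x hx => ⟨hp.trans_le hx.1, hx.2⟩
  refine exists_le_muNorm hAS hμ fun ⟨s, q⟩ ⟨hs, hq⟩ => ?_
  obtain rfl : s = 1 := hs
  obtain ⟨C, hC⟩ := exists_eLpNorm_le_of_support_subset (F := Eu N) hΩ
    (ENNReal.ofReal_pos.2 (one_pos.trans hp)).ne' (ENNReal.ofReal_le_ofReal hq.1)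
  refine ⟨C, fun φ => ?_⟩
  simpa [semi] using hC (gradient φ) (continuous_gradient φ).aestronglyMeasurable
    (support_gradient_subset φ)

theorem exists_fracSobolevNorm_le_muNorm (hΩ : volume (Ω : Set (Eu N)) ≠ ∞) {s p : ℝ}
    (hs : 0 < s) (hp : p ∈ Ioo 1 (N : ℝ)) (hμ : μ (Ico s 1 ×ˢ {p}) ≠ 0) :
    ∃ C : ℝ≥0, ∀ φ : 𝓓(Ω, ℝ), fracSobolevNorm s p φ ≤ C * muNorm μ φ := by
  have hp0 : 0 < p := one_pos.trans hp.1
  have hN : 1 ≤ N := by exact_mod_cast (hp.1.trans hp.2).le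
  have hAS : (Ico s 1 ×ˢ {p} : Set (ℝ × ℝ)) ⊆ Sig N :=
    prod_mono (fun σ hσ => ⟨hs.le.trans hσ.1, hσ.2.le⟩) (by simpa using hp)
  refine exists_le_muNorm hAS hμ fun ⟨σ, p'⟩ hz => ?_
  have hσ : 0 < σ := hs.trans_le hz.1.1
  obtain rfl : p' = p := hz.2
  obtain ⟨C₁, hC₁⟩ := exists_gagliardo_le hN hs hz.1.1 hz.1.2 hp.1
  obtain ⟨C₂, hC₂⟩ := exists_eLpNorm_le_semi hΩ (hAS hz) (ENNReal.ofReal_pos.2 hp0).ne'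
    (ENNReal.ofReal_le_ofReal (le_critExp hσ.le hp0.le (mul_lt_of_mem_Sig (hAS hz))))
  refine ⟨C₂ + C₁ * (1 + C₂), fun φ => ?_⟩
  have hsemi : semi N σ p' φ = gagliardo N σ p' φ := by simp [semi, hσ.ne', hz.1.2.ne]
  calc fracSobolevNorm s p' φ
      ≤ eLpNorm φ (ENNReal.ofReal p') volume +
          C₁ * (semi N σ p' φ + eLpNorm φ (ENNReal.ofReal p') volume) :=
        add_le_add_right (hsemi ▸ hC₁ φ φ.continuous.stronglyMeasurable) _
    _ ≤ C₂ * semi N σ p' φ + C₁ * (semi N σ p' φ + C₂ * semi N σ p' φ) := by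
        gcongr <;> exact hC₂ φ
    _ = (C₂ + C₁ * (1 + C₂) : ℝ≥0) * semi N σ p' φ := by push_cast; ring

end Control

/-! ### Weak gradients and closability -/

section IntegrationByParts

variable {E : Type*} [NormedAddCommGroup E] [InnerProductSpace ℝ E] [FiniteDimensional ℝ E]

theorem inner_gradient (f : E → ℝ) (x v : E) : inner ℝ v (gradient f x) = fderiv ℝ f x v := by
  rw [real_inner_comm, gradient, InnerProductSpace.toDual_symm_apply]

variable [MeasurableSpace E] [BorelSpace E] {ν : Measure E} [ν.IsAddHaarMeasure]

theorem integral_smul_gradient_eq_neg {f g : E → ℝ}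
    (hfg' : Integrable (fun x => f x • gradient g x) ν)
    (hgf' : Integrable (fun x => g x • gradient f x) ν) (hfg : Integrable (fun x => f x * g x) ν)
    (hf : Differentiable ℝ f) (hg : Differentiable ℝ g) :
    ∫ x, f x • gradient g x ∂ν = -∫ x, g x • gradient f x ∂ν := by
  have hinner (a b : E → ℝ) (v : E) : (fun x => inner ℝ v (a x • gradient b x)) =
      fun x => a x * fderiv ℝ b x v := by
    funext x
    rw [real_inner_smul_right, inner_gradient]
  refine ext_inner_left ℝ fun v => ?_
  have hfg'v := hfg'.const_inner (𝕜 := ℝ) v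
  have hgf'v := hgf'.const_inner (𝕜 := ℝ) v
  rw [inner_neg_right, ← integral_inner hfg', ← integral_inner hgf']
  simp only [hinner] at hfg'v hgf'v ⊢
  simpa only [mul_comm] using integral_mul_fderiv_eq_neg_fderiv_mul_of_integrable
    (by simpa only [mul_comm] using hgf'v) hfg'v hfg (fun x _ => hf x) fun x _ => hg x

end IntegrationByParts

section TestToLp

variable {N : ℕ} {Ω : Opens (Eu N)}

/-- The inclusion of the test functions on `Ω` in `L^p(ℝ^N)`. -/
def testToLp (p : ℝ≥0∞) : 𝓓(Ω, ℝ) →ₗ[ℝ] Lp ℝ p (volume : Measure (Eu N)) where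
  toFun φ := (memLp_testFunction φ p).toLp
  map_add' _ _ := MemLp.toLp_add _ _
  map_smul' c _ := MemLp.toLp_const_smul c _

/-- The gradient of test functions on `Ω`, as a linear map to `L^p(ℝ^N)`. -/
def gradientToLp (p : ℝ≥0∞) : 𝓓(Ω, ℝ) →ₗ[ℝ] Lp (Eu N) p (volume : Measure (Eu N)) where
  toFun φ := (memLp_gradient φ p).toLp
  map_add' φ ψ := (MemLp.toLp_congr _ ((memLp_gradient φ p).add (memLp_gradient ψ p))
    (.of_eq (gradient_add φ ψ))).trans (MemLp.toLp_add _ _)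
  map_smul' c φ := (MemLp.toLp_congr _ ((memLp_gradient φ p).const_smul c)
    (.of_eq (gradient_smul c φ))).trans (MemLp.toLp_const_smul c _)

theorem coeFn_testToLp (p : ℝ≥0∞) (φ : 𝓓(Ω, ℝ)) : testToLp p φ =ᵐ[volume] φ :=
  MemLp.coeFn_toLp (memLp_testFunction φ p)

theorem coeFn_gradientToLp (p : ℝ≥0∞) (φ : 𝓓(Ω, ℝ)) : gradientToLp p φ =ᵐ[volume] gradient φ :=
  MemLp.coeFn_toLp (memLp_gradient φ p)

theorem enorm_testToLp (p : ℝ≥0∞) (φ : 𝓓(Ω, ℝ)) : ‖testToLp p φ‖ₑ = eLpNorm φ p volume :=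
  Lp.enorm_toLp (memLp_testFunction φ p)

theorem enorm_gradientToLp (p : ℝ≥0∞) (φ : 𝓓(Ω, ℝ)) :
    ‖gradientToLp p φ‖ₑ = eLpNorm (gradient φ) p volume :=
  Lp.enorm_toLp (memLp_gradient φ p)

end TestToLp

section WeakGradient

variable {N : ℕ} {Ω : Opens (Eu N)} {p q : ℝ≥0∞}

theorem hasWeakGradient_congr {f f' : Eu N → ℝ} {g g' : Eu N → Eu N}
    (hf : f =ᵐ[volume.restrict (Ω : Set (Eu N))] f')
    (hg : g =ᵐ[volume.restrict (Ω : Set (Eu N))] g') :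
    HasWeakGradient Ω f g ↔ HasWeakGradient Ω f' g' := by
  refine and_congr (locallyIntegrableOn_congr hf) (and_congr (locallyIntegrableOn_congr hg)
    (forall_congr' fun φ => ?_))
  rw [integral_congr_ae (hf.mono fun x hx => congrArg (· • gradient φ x) hx),
    integral_congr_ae (hg.mono fun x hx => congrArg (φ x • ·) hx)]

theorem sobolevNorm_congr {r : ℝ} {f f' : Eu N → ℝ}
    (h : f =ᵐ[volume.restrict (Ω : Set (Eu N))] f') : sobolevNorm Ω r f = sobolevNorm Ω r f' := by
  simp only [sobolevNorm, eLpNorm_congr_ae h, hasWeakGradient_congr h .rfl]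

theorem hasWeakGradient_iff {f : Lp ℝ q (volume : Measure (Eu N))}
    {g : Lp (Eu N) p (volume : Measure (Eu N))} (hq : 1 ≤ q) (hp : 1 ≤ p) :
    HasWeakGradient Ω f g ↔
      ∀ φ : 𝓓(Ω, ℝ), ∫ x, f x • gradient φ x = -∫ x, φ x • g x := by
  have hf : LocallyIntegrableOn f (Ω : Set (Eu N)) :=
    ((Lp.memLp f).locallyIntegrable hq).locallyIntegrableOn _
  have hg : LocallyIntegrableOn g (Ω : Set (Eu N)) :=
    ((Lp.memLp g).locallyIntegrable hp).locallyIntegrableOn _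
  simp only [HasWeakGradient, hf, hg, true_and]
  refine forall_congr' fun φ => ?_
  rw [setIntegral_eq_integral_of_forall_compl_eq_zero fun x hx => by
      rw [Function.notMem_support.1 fun h => hx (support_gradient_subset φ h), smul_zero],
    setIntegral_eq_integral_of_forall_compl_eq_zero fun x hx => by
      rw [Function.notMem_support.1 fun h => hx (support_subset φ h), zero_smul]]

theorem hasWeakGradient_testToLp (hq : 1 ≤ q) (hp : 1 ≤ p) (φ : 𝓓(Ω, ℝ)) :
    HasWeakGradient Ω (testToLp q φ) (gradientToLp p φ) := by
  have hint (φ ψ : 𝓓(Ω, ℝ)) : Integrable fun x => φ x • gradient ψ x :=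
    (φ.continuous.smul (continuous_gradient ψ)).integrable_of_hasCompactSupport
      φ.hasCompactSupport.smul_right
  refine (hasWeakGradient_iff hq hp).2 fun ψ => ?_
  rw [integral_congr_ae ((coeFn_testToLp q φ).mono fun x hx => congrArg (· • gradient ψ x) hx),
    integral_congr_ae ((coeFn_gradientToLp p φ).mono fun x hx => congrArg (ψ x • ·) hx)]
  exact integral_smul_gradient_eq_neg (hint φ ψ) (hint ψ φ)
    ((φ.continuous.mul ψ.continuous).integrable_of_hasCompactSupport
      φ.hasCompactSupport.mul_right)
    ((contDiff_one φ).differentiable one_ne_zero) ((contDiff_one ψ).differentiable one_ne_zero)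

theorem continuous_integral_smul_gradient [Fact (1 ≤ q)] (φ : 𝓓(Ω, ℝ)) :
    Continuous fun f : Lp ℝ q (volume : Measure (Eu N)) => ∫ x, f x • gradient φ x := by
  have : Fact (1 ≤ q.conjExponent) := ⟨(ENNReal.HolderConjugate.conjExponent Fact.out).symm.one_le⟩
  let B := ContinuousLinearMap.lpPairing (volume : Measure (Eu N)) q q.conjExponent
    (ContinuousLinearMap.lsmul ℝ ℝ : ℝ →L[ℝ] Eu N →L[ℝ] Eu N)
  refine (B.flip (gradientToLp _ φ)).continuous.congr fun f => ?_
  rw [ContinuousLinearMap.flip_apply, ContinuousLinearMap.lpPairing_eq_integral]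
  exact integral_congr_ae <|
    (coeFn_gradientToLp _ φ).mono fun x hx => congrArg (f x • ·) hx

theorem continuous_integral_testFunction_smul [Fact (1 ≤ p)] (φ : 𝓓(Ω, ℝ)) :
    Continuous fun g : Lp (Eu N) p (volume : Measure (Eu N)) => ∫ x, φ x • g x := by
  have : Fact (1 ≤ p.conjExponent) := ⟨(ENNReal.HolderConjugate.conjExponent Fact.out).symm.one_le⟩
  let B := ContinuousLinearMap.lpPairing (volume : Measure (Eu N)) p.conjExponent p
    (ContinuousLinearMap.lsmul ℝ ℝ : ℝ →L[ℝ] Eu N →L[ℝ] Eu N)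
  refine (B (testToLp _ φ)).continuous.congr fun g => ?_
  rw [ContinuousLinearMap.lpPairing_eq_integral]
  exact integral_congr_ae <| (coeFn_testToLp _ φ).mono fun x hx => congrArg (· • g x) hx

theorem isClosed_setOf_hasWeakGradient [Fact (1 ≤ q)] [Fact (1 ≤ p)] :
    IsClosed {fg : Lp ℝ q (volume : Measure (Eu N)) × Lp (Eu N) p (volume : Measure (Eu N)) |
      HasWeakGradient Ω fg.1 fg.2} := by
  simp only [hasWeakGradient_iff (q := q) (p := p) Fact.out Fact.out, ofPred_forall]
  exact isClosed_iInter fun φ => isClosed_eq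
    ((continuous_integral_smul_gradient φ).comp continuous_fst)
    ((continuous_integral_testFunction_smul φ).comp continuous_snd).neg

theorem HasWeakGradient.ae_eq_zero {f : Eu N → ℝ} {g : Eu N → Eu N} (h : HasWeakGradient Ω f g)
    (hf : f =ᵐ[volume.restrict (Ω : Set (Eu N))] 0) :
    g =ᵐ[volume.restrict (Ω : Set (Eu N))] 0 := by
  refine (ae_restrict_iff' Ω.isOpen.measurableSet).2 <|
    Ω.isOpen.ae_eq_zero_of_integral_contDiff_smul_eq_zero h.2.1 fun ψ hψ hψc hψΩ => ?_
  have hparts := ((hasWeakGradient_congr hf .rfl).1 h).2.2 ⟨ψ, hψ, hψc, hψΩ⟩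
  simp only [Pi.zero_apply, zero_smul, integral_zero, zero_eq_neg, TestFunction.coe_mk] at hparts
  rwa [← setIntegral_eq_integral_of_forall_compl_eq_zero fun x hx => by
    rw [image_eq_zero_of_notMem_tsupport fun hx' => hx (hψΩ hx'), zero_smul]]

end WeakGradient

section Closability

variable {N : ℕ} {Ω : Opens (Eu N)} {s p : ℝ} {φ : ℕ → 𝓓(Ω, ℝ)}

theorem semi_sub_le_sum (hp : 1 < p) (φ : ℕ → 𝓓(Ω, ℝ)) (n : ℕ) :
    semi N s p ⇑(φ 0 - φ n) ≤ ∑ m ∈ Finset.range n, semi N s p ⇑(φ m - φ (m + 1)) := by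
  induction n with
  | zero =>
    have hzero : (⇑(φ 0 - φ 0) : Eu N → ℝ) = (0 : ℝ) • ⇑(φ 0) := by ext x; simp
    rw [hzero, semi_smul hp]
    simp
  | succ n ih =>
    have hsplit : (⇑(φ 0 - φ (n + 1)) : Eu N → ℝ) = ⇑(φ 0 - φ n) + ⇑(φ n - φ (n + 1)) := by
      ext x; simp
    rw [Finset.sum_range_succ, hsplit]
    exact (semi_add hp _ _).trans (by gcongr)

theorem semi_le_tsum_of_lowerSemicontinuous (hp : 1 < p)
    (hφ : Tendsto (fun n => testToLp 1 (φ n)) atTop (𝓝 0))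
    {Φ : Lp ℝ 1 (volume : Measure (Eu N)) → ℝ≥0∞} (hΦ : LowerSemicontinuous Φ)
    (hΦs : ∀ ψ : 𝓓(Ω, ℝ), Φ (testToLp 1 ψ) = semi N s p ψ) :
    semi N s p (φ 0) ≤ ∑' m, semi N s p ⇑(φ m - φ (m + 1)) := by
  have hlim : Tendsto (fun n => testToLp 1 (φ 0 - φ n)) atTop (𝓝 (testToLp 1 (φ 0))) := by
    simpa only [map_sub, sub_zero] using hφ.const_sub (testToLp 1 (φ 0))
  rw [← hΦs]
  exact (hΦ.isClosed_preimage _).mem_of_tendsto hlim <| Eventually.of_forall fun n =>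
    (hΦs _).trans_le ((semi_sub_le_sum hp φ n).trans (ENNReal.sum_le_tsum _))

theorem eLpNorm_gradient_le_tsum {p : ℝ≥0∞} [Fact (1 ≤ p)]
    (hφ : Tendsto (fun n => testToLp 1 (φ n)) atTop (𝓝 0)) :
    eLpNorm (gradient (φ 0)) p volume ≤ ∑' m, eLpNorm (gradient ⇑(φ m - φ (m + 1))) p volume := by
  set d : ℕ → ℝ≥0∞ := fun m => eLpNorm (gradient ⇑(φ m - φ (m + 1))) p volume
  rcases eq_or_ne (∑' m, d m) ∞ with htop | htop
  · exact htop ▸ le_top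
  have hd (n : ℕ) : edist (gradientToLp p (φ n)) (gradientToLp p (φ (n + 1))) ≤ d n := by
    rw [edist_eq_enorm_sub, ← map_sub, enorm_gradientToLp]
  obtain ⟨g, hg⟩ := cauchySeq_tendsto_of_complete (cauchySeq_of_edist_le_of_tsum_ne_top d hd htop)
  have hweak : HasWeakGradient Ω (0 : Lp ℝ 1 (volume : Measure (Eu N))) g :=
    (isClosed_setOf_hasWeakGradient (Ω := Ω) (q := 1) (p := p)).mem_of_tendsto (hφ.prodMk_nhds hg)
      (Eventually.of_forall fun n => hasWeakGradient_testToLp le_rfl (Fact.out : 1 ≤ p) (φ n))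
  have hg0 := hweak.ae_eq_zero (ae_restrict_of_ae (Lp.coeFn_zero ℝ 1 volume))
  calc eLpNorm (gradient (φ 0)) p volume
      = eLpNorm (gradientToLp p (φ 0) - g) p (volume.restrict (Ω : Set (Eu N))) := by
        rw [← eLpNorm_restrict_eq_of_support_subset (support_gradient_subset (φ 0))]
        refine eLpNorm_congr_ae ?_
        filter_upwards [hg0, ae_restrict_of_ae (coeFn_gradientToLp p (φ 0)),
          ae_restrict_of_ae (Lp.coeFn_sub (gradientToLp p (φ 0)) g)] with x hgx hφx hsubx
        simp_all
    _ ≤ edist (gradientToLp p (φ 0)) g := by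
        rw [edist_eq_enorm_sub, Lp.enorm_def]
        exact eLpNorm_mono_measure _ Measure.restrict_le_self
    _ ≤ ∑' m, d m := edist_le_tsum_of_edist_le_of_tendsto₀ d hd hg

theorem semi_le_tsum (hp : 1 < p) (hφ : Tendsto (fun n => testToLp 1 (φ n)) atTop (𝓝 0)) :
    semi N s p (φ 0) ≤ ∑' m, semi N s p ⇑(φ m - φ (m + 1)) := by
  by_cases hs0 : s = 0
  · refine semi_le_tsum_of_lowerSemicontinuous hp hφ
      (lowerSemicontinuous_eLpNorm (ENNReal.ofReal p)) fun ψ => ?_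
    rw [eLpNorm_congr_ae (coeFn_testToLp 1 ψ), semi, if_pos hs0]
  by_cases hs1 : s = 1
  · have : Fact (1 ≤ ENNReal.ofReal p) := ⟨by simpa using hp.le⟩
    simpa only [semi, hs1, one_ne_zero, if_true, if_false] using
      eLpNorm_gradient_le_tsum (p := ENNReal.ofReal p) hφ
  · refine semi_le_tsum_of_lowerSemicontinuous hp hφ
      (lowerSemicontinuous_gagliardo s (one_pos.trans hp).le) fun ψ => ?_
    rw [gagliardo_congr_ae (coeFn_testToLp 1 ψ), semi, if_neg hs0, if_neg hs1]

theorem muNorm_le_tsum (μ : Measure (ℝ × ℝ))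
    (hφ : Tendsto (fun n => testToLp 1 (φ n)) atTop (𝓝 0)) :
    muNorm μ (φ 0) ≤ ∑' m, muNorm μ ⇑(φ m - φ (m + 1)) := by
  unfold muNorm
  rw [← lintegral_tsum fun m => aemeasurable_semi μ _]
  exact setLIntegral_mono' (measurableSet_Icc.prod measurableSet_Ioo)
    fun z hz => semi_le_tsum hz.2.1 hφ

end Closability

/-! ### The elements of `X_μ(Ω)` as functions -/

section Extension

variable {N : ℕ} {Ω : Opens (Eu N)} {μ : Measure (ℝ × ℝ)} [IsFiniteMeasure μ]

theorem enorm_toX (φ : 𝓓(Ω, ℝ)) : ‖toX μ φ‖ₑ = muNorm μ φ := by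
  rw [← ofReal_norm, norm_toX]

theorem toX_sub (φ ψ : 𝓓(Ω, ℝ)) : toX μ (φ - ψ) = toX μ φ - toX μ ψ :=
  UniformSpace.Completion.coe_sub (α := PreX μ Ω) φ ψ

theorem denseRange_toX : DenseRange (toX μ : 𝓓(Ω, ℝ) → X μ Ω) :=
  UniformSpace.Completion.denseRange_coe (α := PreX μ Ω)

theorem exists_extension {F : Type*} [NormedAddCommGroup F] [NormedSpace ℝ F] [CompleteSpace F]
    (L : 𝓓(Ω, ℝ) →ₗ[ℝ] F) {C : ℝ≥0} (hL : ∀ φ, ‖L φ‖ₑ ≤ C * muNorm μ φ) :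
    ∃ T : X μ Ω →L[ℝ] F, ∀ φ, T (toX μ φ) = L φ := by
  let f : PreX μ Ω →ₗ[ℝ] F := L
  have hf (φ : PreX μ Ω) : ‖f φ‖ ≤ C * ‖φ‖ := by
    have hφ : ‖φ‖ = (muNorm μ (show 𝓓(Ω, ℝ) from φ)).toReal := rfl
    rw [hφ, ← toReal_enorm, ← ENNReal.coe_toReal, ← ENNReal.toReal_mul]
    exact ENNReal.toReal_mono (ENNReal.mul_ne_top ENNReal.coe_ne_top (muNorm_ne_top μ _)) (hL φ)
  exact ⟨(f.mkContinuous C hf).extend UniformSpace.Completion.toComplL,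
    (f.mkContinuous C hf).extend_eq UniformSpace.Completion.denseRange_coe
      (UniformSpace.Completion.isUniformInducing_coe _)⟩

theorem le_of_lowerSemicontinuous {Φ : X μ Ω → ℝ≥0∞} (hΦ : LowerSemicontinuous Φ) {C : ℝ≥0}
    (hC : ∀ φ, Φ (toX μ φ) ≤ C * muNorm μ φ) (u : X μ Ω) : Φ u ≤ C * ‖u‖ₑ := by
  have hcont : Continuous fun u : X μ Ω => (u, C * ‖u‖ₑ) :=
    continuous_id.prodMk ((ENNReal.continuous_const_mul ENNReal.coe_ne_top).comp continuous_enorm)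
  exact denseRange_toX.induction_on u (hΦ.isClosed_epigraph.preimage hcont) fun φ =>
    (hC φ).trans_eq (by rw [enorm_toX])

theorem exists_apply_sub_toX_lt {Φ : X μ Ω → ℝ≥0∞} {C : ℝ≥0} (hΦ : ∀ u, Φ u ≤ C * ‖u‖ₑ)
    (u : X μ Ω) {ε : ℝ≥0∞} (hε : 0 < ε) : ∃ φ, Φ (u - toX μ φ) < ε := by
  have hcont : Continuous fun v : X μ Ω => C * ‖u - v‖ₑ :=
    (ENNReal.continuous_const_mul ENNReal.coe_ne_top).comp
      (continuous_enorm.comp (continuous_const.sub continuous_id))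
  obtain ⟨φ, hφ⟩ := denseRange_toX.exists_mem_open (hcont.isOpen_preimage _ isOpen_Iio)
    ⟨u, show C * ‖u - u‖ₑ < ε by simpa using hε⟩
  exact ⟨φ, (hΦ _).trans_lt hφ⟩

theorem coe_mul_enorm_le_ofReal {V : Type*} [SeminormedAddCommGroup V] (C : ℝ≥0) (v : V) :
    C * ‖v‖ₑ ≤ ENNReal.ofReal ((C + 1) * ‖v‖) := by
  rw [ENNReal.ofReal_mul (by positivity), ofReal_norm, ← ENNReal.ofReal_coe_nnreal]
  gcongr
  exact le_add_of_nonneg_right zero_le_one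

end Extension

section Realization

variable {N : ℕ} {Ω : Opens (Eu N)}

/-- The class on `Ω` of an integrable function on `ℝ^N`. -/
def restrictLp (Ω : Opens (Eu N)) : Lp ℝ 1 (volume : Measure (Eu N)) →ₗ[ℝ] MeasFun Ω :=
  (Lp.LpSubmodule ℝ ℝ 1 (volume.restrict (Ω : Set (Eu N)))).subtype ∘ₗ
    (LpToLpRestrictCLM (Eu N) ℝ ℝ volume 1 (Ω : Set (Eu N))).toLinearMap

theorem coeFn_restrictLp (f : Lp ℝ 1 (volume : Measure (Eu N))) :
    restrictLp Ω f =ᵐ[volume.restrict (Ω : Set (Eu N))] f :=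
  LpToLpRestrictCLM_coeFn ℝ (Ω : Set (Eu N)) f

variable {μ : Measure (ℝ × ℝ)} [IsFiniteMeasure μ]
  {T : X μ Ω →L[ℝ] Lp ℝ 1 (volume : Measure (Eu N))}

theorem ae_restrict_compl_eq_zero (hT : ∀ φ, T (toX μ φ) = testToLp 1 φ) (u : X μ Ω) :
    T u =ᵐ[volume.restrict (Ω : Set (Eu N))ᶜ] 0 := by
  let R := LpToLpRestrictCLM (Eu N) ℝ ℝ volume 1 (Ω : Set (Eu N))ᶜ
  have hcoe (u : X μ Ω) := LpToLpRestrictCLM_coeFn ℝ (Ω : Set (Eu N))ᶜ (T u)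
  suffices hR : R (T u) = 0 from (hcoe u).symm.trans (hR ▸ Lp.coeFn_zero ℝ 1 _)
  refine denseRange_toX.induction_on u
    (isClosed_eq (R.continuous.comp T.continuous) continuous_const) fun φ => ?_
  refine Lp.ext ((hcoe _).trans (.trans ?_ (Lp.coeFn_zero ℝ 1 _).symm))
  filter_upwards [ae_restrict_of_ae (hT φ ▸ coeFn_testToLp 1 φ),
    ae_restrict_mem Ω.isOpen.measurableSet.compl] with x hx hxΩ
  rw [hx, Pi.zero_apply, Function.notMem_support.1 fun h => hxΩ (support_subset φ h)]

theorem zeroExt_restrictLp_ae_eq (hT : ∀ φ, T (toX μ φ) = testToLp 1 φ) (u : X μ Ω) :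
    zeroExt (restrictLp Ω (T u)) =ᵐ[volume] T u := by
  have hΩm := Ω.isOpen.measurableSet
  exact ae_of_ae_restrict_of_ae_restrict_compl (Ω : Set (Eu N))
    ((indicator_ae_eq_restrict hΩm).trans (coeFn_restrictLp (T u)))
    ((indicator_ae_eq_restrict_compl hΩm).trans (ae_restrict_compl_eq_zero hT u).symm)

theorem exists_seq_tendsto_toX (u : X μ Ω) : ∃ φ : ℕ → 𝓓(Ω, ℝ),
    Tendsto (fun n => toX μ (φ n)) atTop (𝓝 u) ∧ ∑' n, muNorm μ ⇑(φ n - φ (n + 1)) ≠ ∞ := by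
  obtain ⟨a, ha0, ha⟩ := ENNReal.exists_pos_sum_of_countable one_ne_zero ℕ
  have hclose (n : ℕ) : ∃ φ, edist (toX μ φ) u < a n :=
    denseRange_toX.exists_mem_open Metric.isOpen_eball
      ⟨u, Metric.mem_eball_self (by simpa using ha0 n)⟩
  choose φ hφ using hclose
  have ha_lim : Tendsto (fun n => (a n : ℝ≥0∞)) atTop (𝓝 0) :=
    ENNReal.tendsto_atTop_zero_of_tsum_ne_top (ha.trans ENNReal.one_lt_top).ne
  refine ⟨φ, tendsto_iff_edist_tendsto_0.2 <| tendsto_of_tendsto_of_tendsto_of_le_of_le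
    tendsto_const_nhds ha_lim (fun _ => zero_le) fun n => (hφ n).le, ?_⟩
  have hd (n : ℕ) : muNorm μ ⇑(φ n - φ (n + 1)) ≤ a n + a (n + 1) := by
    rw [← enorm_toX, toX_sub, ← edist_eq_enorm_sub]
    exact (edist_triangle_right _ _ u).trans (add_le_add (hφ n).le (hφ (n + 1)).le)
  refine ne_top_of_le_ne_top (b := 1 + 1) (by finiteness) ((ENNReal.tsum_le_tsum hd).trans ?_)
  rw [ENNReal.tsum_add]
  exact add_le_add ha.le ((ENNReal.tsum_comp_le_tsum_of_injective (add_left_injective 1)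
    fun n => (a n : ℝ≥0∞)).trans ha.le)

theorem eq_zero_of_extension_eq_zero (hT : ∀ φ, T (toX μ φ) = testToLp 1 φ) {u : X μ Ω}
    (hu : T u = 0) : u = 0 := by
  obtain ⟨φ, hlim, hsum⟩ := exists_seq_tendsto_toX u
  have hLp : Tendsto (fun n => testToLp 1 (φ n)) atTop (𝓝 0) := by
    simpa only [Function.comp_def, hT, hu] using (T.continuous.tendsto u).comp hlim
  have hbound (n : ℕ) : ‖toX μ (φ n)‖ₑ ≤ ∑' m, muNorm μ ⇑(φ (m + n) - φ (m + n + 1)) := by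
    have h := muNorm_le_tsum μ (φ := fun m => φ (m + n)) (hLp.comp (tendsto_add_atTop_nat n))
    simpa only [enorm_toX, zero_add, add_right_comm] using h
  have hzero : Tendsto (fun n => ‖toX μ (φ n)‖ₑ) atTop (𝓝 0) :=
    tendsto_of_tendsto_of_tendsto_of_le_of_le tendsto_const_nhds
      (ENNReal.tendsto_sum_nat_add _ hsum) (fun _ => zero_le) hbound
  exact enorm_eq_zero.1 (tendsto_nhds_unique hlim.enorm hzero)

theorem restrictLp_comp_injective (hT : ∀ φ, T (toX μ φ) = testToLp 1 φ) :
    Function.Injective (restrictLp Ω ∘ₗ T.toLinearMap) := by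
  refine (injective_iff_map_eq_zero _).2 fun u hu => eq_zero_of_extension_eq_zero hT ?_
  have hu0 : restrictLp Ω (T u) = 0 := hu
  have hΩ0 : T u =ᵐ[volume.restrict (Ω : Set (Eu N))] 0 :=
    (coeFn_restrictLp (T u)).symm.trans (hu0 ▸ AEEqFun.coeFn_zero)
  exact Lp.eq_zero_iff_ae_eq_zero.2 <|
    ae_of_ae_restrict_of_ae_restrict_compl _ hΩ0 (ae_restrict_compl_eq_zero hT u)

theorem exists_hasWeakGradient {p : ℝ≥0∞} [Fact (1 ≤ p)] {C : ℝ≥0}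
    (hT : ∀ φ, T (toX μ φ) = testToLp 1 φ)
    (hC : ∀ φ : 𝓓(Ω, ℝ), eLpNorm (gradient φ) p volume ≤ C * muNorm μ φ) (u : X μ Ω) :
    ∃ g, HasWeakGradient Ω (T u) g ∧ eLpNorm g p volume ≤ C * ‖u‖ₑ := by
  obtain ⟨D, hD⟩ := exists_extension (gradientToLp p) fun φ =>
    (enorm_gradientToLp p φ).trans_le (hC φ)
  refine ⟨D u, ?_, ?_⟩
  · refine denseRange_toX.induction_on u ((isClosed_setOf_hasWeakGradient (q := 1)).preimage
      (T.continuous.prodMk D.continuous)) fun φ => ?_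
    simpa only [hT, hD] using hasWeakGradient_testToLp le_rfl Fact.out φ
  · rw [← Lp.enorm_def]
    refine le_of_lowerSemicontinuous (continuous_enorm.comp D.continuous).lowerSemicontinuous
      (fun φ => ?_) u
    rw [Function.comp_apply, hD, enorm_gradientToLp]
    exact hC φ

theorem eLpNorm_extension_le (hT : ∀ φ, T (toX μ φ) = testToLp 1 φ) {q : ℝ≥0∞} {C : ℝ≥0}
    (hC : ∀ φ : 𝓓(Ω, ℝ), eLpNorm φ q volume ≤ C * muNorm μ φ) (u : X μ Ω) :
    eLpNorm (T u) q volume ≤ C * ‖u‖ₑ := by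
  refine le_of_lowerSemicontinuous ((lowerSemicontinuous_eLpNorm q).comp T.continuous)
    (fun φ => ?_) u
  rw [Function.comp_apply, hT, eLpNorm_congr_ae (coeFn_testToLp 1 φ)]
  exact hC φ

theorem sobolevNorm_extension_le (hT : ∀ φ, T (toX μ φ) = testToLp 1 φ) {p : ℝ} (hp : 1 ≤ p)
    {C₁ C₂ : ℝ≥0} (hC₁ : ∀ φ : 𝓓(Ω, ℝ), eLpNorm φ (ENNReal.ofReal p) volume ≤ C₁ * muNorm μ φ)
    (hC₂ : ∀ φ : 𝓓(Ω, ℝ), eLpNorm (gradient φ) (ENNReal.ofReal p) volume ≤ C₂ * muNorm μ φ)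
    (u : X μ Ω) : sobolevNorm Ω p (T u) ≤ (C₁ + C₂ : ℝ≥0) * ‖u‖ₑ := by
  have : Fact (1 ≤ ENNReal.ofReal p) := ⟨by simpa using hp⟩
  obtain ⟨g, hg, hgC⟩ := exists_hasWeakGradient hT hC₂ u
  rw [ENNReal.coe_add, add_mul]
  exact add_le_add
    ((eLpNorm_mono_measure _ Measure.restrict_le_self).trans (eLpNorm_extension_le hT hC₁ u))
    ((iInf₂_le g hg).trans ((eLpNorm_mono_measure _ Measure.restrict_le_self).trans hgC))

theorem fracSobolevNorm_congr_ae {f g : Eu N → ℝ} (h : f =ᵐ[volume] g) (s p : ℝ) :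
    fracSobolevNorm s p f = fracSobolevNorm s p g := by
  rw [fracSobolevNorm, fracSobolevNorm, eLpNorm_congr_ae h, gagliardo_congr_ae h]

theorem fracSobolevNorm_extension_le (hT : ∀ φ, T (toX μ φ) = testToLp 1 φ) {s p : ℝ}
    (hp : 0 ≤ p) {C : ℝ≥0} (hC : ∀ φ : 𝓓(Ω, ℝ), fracSobolevNorm s p φ ≤ C * muNorm μ φ)
    (u : X μ Ω) : fracSobolevNorm s p (T u) ≤ C * ‖u‖ₑ := by
  refine le_of_lowerSemicontinuous
    (((lowerSemicontinuous_eLpNorm _).add (lowerSemicontinuous_gagliardo s hp)).comp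
      T.continuous) (fun φ => ?_) u
  exact (fracSobolevNorm_congr_ae (hT φ ▸ coeFn_testToLp 1 φ) s p).trans_le (hC φ)

theorem extension_sub_toX_ae_eq (hT : ∀ φ, T (toX μ φ) = testToLp 1 φ) (u : X μ Ω) (φ : 𝓓(Ω, ℝ)) :
    T (u - toX μ φ) =ᵐ[volume] fun x => T u x - φ x := by
  rw [map_sub, hT]
  exact (Lp.coeFn_sub _ _).trans (EventuallyEq.rfl.sub (coeFn_testToLp 1 φ))

theorem restrictLp_mem_W01 (hT : ∀ φ, T (toX μ φ) = testToLp 1 φ) {p : ℝ} {C : ℝ≥0}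
    (hC : ∀ u, sobolevNorm Ω p (T u) ≤ C * ‖u‖ₑ) (u : X μ Ω) : restrictLp Ω (T u) ∈ W01 Ω p := by
  intro ε hε
  obtain ⟨φ, hφ⟩ := exists_apply_sub_toX_lt hC u hε
  have hsub : T (u - toX μ φ) =ᵐ[volume.restrict (Ω : Set (Eu N))] fun x => T u x - φ x :=
    ae_restrict_of_ae (extension_sub_toX_ae_eq hT u φ)
  refine ⟨φ, (sobolevNorm_congr ?_).trans_lt hφ⟩
  exact ((coeFn_restrictLp (T u)).sub .rfl).trans hsub.symm

theorem restrictLp_mem_W0s (hT : ∀ φ, T (toX μ φ) = testToLp 1 φ) {s p : ℝ} {C : ℝ≥0}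
    (hC : ∀ u, fracSobolevNorm s p (T u) ≤ C * ‖u‖ₑ) (u : X μ Ω) :
    restrictLp Ω (T u) ∈ W0s Ω s p := by
  intro ε hε
  obtain ⟨φ, hφ⟩ := exists_apply_sub_toX_lt hC u hε
  refine ⟨φ, (fracSobolevNorm_congr_ae ?_ s p).trans_lt hφ⟩
  exact ((zeroExt_restrictLp_ae_eq hT u).sub .rfl).trans (extension_sub_toX_ae_eq hT u φ).symm

end Realization

section Embeddings

variable {N : ℕ} {Ω : Opens (Eu N)} {μ : Measure (ℝ × ℝ)} [IsFiniteMeasure μ]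

theorem exists_extension_testToLp (hΩ : volume (Ω : Set (Eu N)) ≠ ∞) (hμ : μ (Sig N) ≠ 0) :
    ∃ T : X μ Ω →L[ℝ] Lp ℝ 1 (volume : Measure (Eu N)), ∀ φ, T (toX μ φ) = testToLp 1 φ := by
  obtain ⟨C, hC⟩ := exists_eLpNorm_le_muNorm (Ω := Ω) hΩ subset_rfl hμ one_ne_zero fun z hz =>
    ENNReal.one_le_ofReal.2 <| hz.2.1.le.trans <|
      le_critExp hz.1.1 (one_pos.trans hz.2.1).le (mul_lt_of_mem_Sig hz)
  exact exists_extension (testToLp 1) fun φ => (enorm_testToLp 1 φ).trans_le (hC φ)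

variable {T : X μ Ω →L[ℝ] Lp ℝ 1 (volume : Measure (Eu N))}

theorem exists_eLpNorm_critExp_restrictLp_le (hΩ : volume (Ω : Set (Eu N)) ≠ ∞)
    (hT : ∀ φ, T (toX μ φ) = testToLp 1 φ) {s p : ℝ} (hs : 0 ≤ s) (hp : 1 < p)
    (hμ : μ (Icc s 1 ×ˢ Ico p N) ≠ 0) : ∃ C : ℝ, 0 < C ∧ ∀ u,
      MemLp (restrictLp Ω (T u)) (ENNReal.ofReal (critExp N s p))
        (volume.restrict (Ω : Set (Eu N))) ∧
      eLpNorm (restrictLp Ω (T u)) (ENNReal.ofReal (critExp N s p))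
        (volume.restrict (Ω : Set (Eu N))) ≤ ENNReal.ofReal (C * ‖u‖) := by
  have hp0 : 0 < p := one_pos.trans hp
  have hAS : (Icc s 1 ×ˢ Ico p N : Set (ℝ × ℝ)) ⊆ Sig N :=
    prod_mono (Icc_subset_Icc_left hs) fun x hx => ⟨hp.trans_le hx.1, hx.2⟩
  have hle (z) (hz : z ∈ Icc s 1 ×ˢ Ico p (N : ℝ)) : critExp N s p ≤ critExp N z.1 z.2 :=
    critExp_le_critExp hs hz.1.1 hp0.le hz.2.1 (mul_lt_of_mem_Sig (hAS hz))
  obtain ⟨z, hz⟩ := nonempty_of_measure_ne_zero hμ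
  have hsp : s * p < N := (mul_le_mul hz.1.1 hz.2.1 hp0.le (hs.trans hz.1.1)).trans_lt
    (mul_lt_of_mem_Sig (hAS hz))
  obtain ⟨C, hC⟩ := exists_eLpNorm_le_muNorm (Ω := Ω) hΩ hAS hμ
    (ENNReal.ofReal_pos.2 (hp0.trans_le (le_critExp hs hp0.le hsp))).ne'
    fun z hz => ENNReal.ofReal_le_ofReal (hle z hz)
  refine ⟨C + 1, by positivity, fun u => ?_⟩
  have hbound : eLpNorm (restrictLp Ω (T u)) (ENNReal.ofReal (critExp N s p))
      (volume.restrict (Ω : Set (Eu N))) ≤ ENNReal.ofReal ((C + 1) * ‖u‖) := by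
    rw [eLpNorm_congr_ae (coeFn_restrictLp (T u))]
    exact (eLpNorm_mono_measure _ Measure.restrict_le_self).trans
      ((eLpNorm_extension_le hT hC u).trans (coe_mul_enorm_le_ofReal C u))
  exact ⟨⟨AEEqFun.aestronglyMeasurable _, hbound.trans_lt ENNReal.ofReal_lt_top⟩, hbound⟩

theorem exists_sobolevNorm_restrictLp_le (hΩ : volume (Ω : Set (Eu N)) ≠ ∞)
    (hT : ∀ φ, T (toX μ φ) = testToLp 1 φ) {p : ℝ} (hp : 1 < p)
    (hμ : μ ({1} ×ˢ Ico p N) ≠ 0) : ∃ C : ℝ, 0 < C ∧ ∀ u,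
      restrictLp Ω (T u) ∈ W01 Ω p ∧
      sobolevNorm Ω p (restrictLp Ω (T u)) ≤ ENNReal.ofReal (C * ‖u‖) := by
  have hp0 : 0 < p := one_pos.trans hp
  have hAS : ({1} ×ˢ Ico p N : Set (ℝ × ℝ)) ⊆ Sig N :=
    prod_mono (by simp) fun x hx => ⟨hp.trans_le hx.1, hx.2⟩
  obtain ⟨C₁, hC₁⟩ := exists_eLpNorm_le_muNorm (Ω := Ω) hΩ hAS hμ (ENNReal.ofReal_pos.2 hp0).ne'
    fun z hz => ENNReal.ofReal_le_ofReal <| hz.2.1.trans <|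
      le_critExp (hAS hz).1.1 (hp0.trans_le hz.2.1).le (mul_lt_of_mem_Sig (hAS hz))
  obtain ⟨C₂, hC₂⟩ := exists_eLpNorm_gradient_le_muNorm (Ω := Ω) hΩ hp hμ
  have hC := sobolevNorm_extension_le hT hp.le hC₁ hC₂
  refine ⟨(C₁ + C₂ : ℝ≥0) + 1, by positivity, fun u => ⟨restrictLp_mem_W01 hT hC u, ?_⟩⟩
  rw [sobolevNorm_congr (coeFn_restrictLp (T u))]
  exact (hC u).trans (coe_mul_enorm_le_ofReal _ u)

theorem exists_fracSobolevNorm_restrictLp_le (hΩ : volume (Ω : Set (Eu N)) ≠ ∞)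
    (hT : ∀ φ, T (toX μ φ) = testToLp 1 φ) {s p : ℝ} (hs : 0 < s) (hp : p ∈ Ioo 1 (N : ℝ))
    (hμ : μ (Ico s 1 ×ˢ {p}) ≠ 0) : ∃ C : ℝ, 0 < C ∧ ∀ u,
      restrictLp Ω (T u) ∈ W0s Ω s p ∧
      fracSobolevNorm s p (zeroExt (restrictLp Ω (T u))) ≤ ENNReal.ofReal (C * ‖u‖) := by
  obtain ⟨C, hC⟩ := exists_fracSobolevNorm_le_muNorm (Ω := Ω) hΩ hs hp hμ
  have hCT := fracSobolevNorm_extension_le hT (one_pos.trans hp.1).le hC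
  refine ⟨C + 1, by positivity, fun u => ⟨restrictLp_mem_W0s hT hCT u, ?_⟩⟩
  rw [fracSobolevNorm_congr_ae (zeroExt_restrictLp_ae_eq hT u)]
  exact (hCT u).trans (coe_mul_enorm_le_ofReal C u)

end Embeddings

end FracSuperposition

end

open MeasureTheory Set TopologicalSpace FracSuperposition in
open scoped ENNReal Distributions in
theorem proposition2p3_general {N : ℕ} {Ω : Opens (EuclideanSpace ℝ (Fin N))}
    (hΩ : volume (Ω : Set (EuclideanSpace ℝ (Fin N))) ≠ ∞)
    (μ : Measure (ℝ × ℝ)) [IsFiniteMeasure μ] (hμ : 0 < μ (Icc 0 1 ×ˢ Ioo 1 (N : ℝ))) :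
    ∃ T : X μ Ω →ₗ[ℝ] MeasFun Ω,
      Function.Injective T ∧
      (∀ φ : 𝓓(Ω, ℝ), T (toX μ φ) =ᵐ[volume.restrict (Ω : Set (EuclideanSpace ℝ (Fin N)))] φ) ∧
      (∀ s : ℝ, 0 ≤ s → ∀ p : ℝ, 1 < p → 0 < μ (Icc s 1 ×ˢ Ico p (N : ℝ)) →
        ∃ C : ℝ, 0 < C ∧ ∀ u : X μ Ω,
          MemLp (T u) (ENNReal.ofReal (N * p / (N - s * p)))
            (volume.restrict (Ω : Set (EuclideanSpace ℝ (Fin N)))) ∧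
          eLpNorm (T u) (ENNReal.ofReal (N * p / (N - s * p)))
            (volume.restrict (Ω : Set (EuclideanSpace ℝ (Fin N)))) ≤
              ENNReal.ofReal (C * ‖u‖)) ∧
      (∀ p : ℝ, 1 < p → 0 < μ ({1} ×ˢ Ico p (N : ℝ)) → ∃ C : ℝ, 0 < C ∧ ∀ u : X μ Ω,
        T u ∈ W01 Ω p ∧ sobolevNorm Ω p (T u) ≤ ENNReal.ofReal (C * ‖u‖)) ∧
      (∀ s : ℝ, 0 < s → ∀ p ∈ Ioo (1 : ℝ) N, 0 < μ (Ico s 1 ×ˢ {p}) →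
        ∃ C : ℝ, 0 < C ∧ ∀ u : X μ Ω,
          T u ∈ W0s Ω s p ∧ fracSobolevNorm s p (zeroExt (T u)) ≤ ENNReal.ofReal (C * ‖u‖)) := by
  obtain ⟨T, hT⟩ := exists_extension_testToLp hΩ hμ.ne'
  refine ⟨restrictLp Ω ∘ₗ T.toLinearMap, restrictLp_comp_injective hT, fun φ => ?_,
    fun s hs p hp hsp => exists_eLpNorm_critExp_restrictLp_le hΩ hT hs hp hsp.ne',
    fun p hp hp' => exists_sobolevNorm_restrictLp_le hΩ hT hp hp'.ne',
    fun s hs p hp hsp => exists_fracSobolevNorm_restrictLp_le hΩ hT hs hp hsp.ne'⟩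
  exact (coeFn_restrictLp (T (toX μ φ))).trans (ae_restrict_of_ae (hT φ ▸ coeFn_testToLp 1 φ))

open MeasureTheory Set TopologicalSpace FracSuperposition in
open scoped ENNReal Distributions in
theorem proposition2p3 (N : ℕ) (hN : 2 ≤ N)
    (Ω : Opens (EuclideanSpace ℝ (Fin N)))
    (hΩ : Bornology.IsBounded (Ω : Set (EuclideanSpace ℝ (Fin N))))
    (μ : Measure (ℝ × ℝ)) [IsFiniteMeasure μ]
    (sbar pbar : ℝ) (hsbar : sbar ∈ Ioc (0 : ℝ) 1) (hpbar : pbar ∈ Ioo (1 : ℝ) N)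
    (hμ : 0 < μ (Icc sbar 1 ×ˢ Ico pbar (N : ℝ))) :
    -- `T` identifies the elements of `X_μ(Ω)` with functions on `Ω`
    ∃ T : X μ Ω →ₗ[ℝ] MeasFun Ω,
      Function.Injective T ∧
      (∀ φ : 𝓓(Ω, ℝ), T (toX μ φ) =ᵐ[volume.restrict (Ω : Set (EuclideanSpace ℝ (Fin N)))] φ) ∧
      (∀ s ∈ Icc sbar 1, ∀ p ∈ Ico pbar (N : ℝ), 0 < μ (Icc s 1 ×ˢ Ico p (N : ℝ)) →
        (s = 1 → ∃ C : ℝ, 0 < C ∧ ∀ u : X μ Ω,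
          T u ∈ W01 Ω p ∧ sobolevNorm Ω p (T u) ≤ ENNReal.ofReal (C * ‖u‖)) ∧
        (s < 1 → ∃ C : ℝ, 0 < C ∧ ∀ u : X μ Ω,
          MemLp (T u) (ENNReal.ofReal (N * p / (N - s * p)))
            (volume.restrict (Ω : Set (EuclideanSpace ℝ (Fin N)))) ∧
          eLpNorm (T u) (ENNReal.ofReal (N * p / (N - s * p)))
            (volume.restrict (Ω : Set (EuclideanSpace ℝ (Fin N)))) ≤
              ENNReal.ofReal (C * ‖u‖))) ∧
      (∀ s₁ ∈ Ioo (0 : ℝ) 1, ∀ p₁ ∈ Ioo (1 : ℝ) N, 0 < μ (Ico s₁ 1 ×ˢ {p₁}) →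
        ∃ C : ℝ, 0 < C ∧ ∀ u : X μ Ω,
          T u ∈ W0s Ω s₁ p₁ ∧
          fracSobolevNorm s₁ p₁ (zeroExt (T u)) ≤ ENNReal.ofReal (C * ‖u‖)) := by
  have hμ' : 0 < μ (Icc 0 1 ×ˢ Ioo 1 (N : ℝ)) := hμ.trans_le <| measure_mono <|
    prod_mono (Icc_subset_Icc_left hsbar.1.le) (Ico_subset_Ioo_left hpbar.1)
  obtain ⟨T, hinj, htest, hLp, hW01, hW0s⟩ :=
    proposition2p3_general hΩ.measure_lt_top.ne μ hμ'
  refine ⟨T, hinj, htest, fun s hs p hp hsp => ⟨?_, fun _ => ?_⟩, fun s hs => hW0s s hs.1⟩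
  · rintro rfl
    exact hW01 p (hpbar.1.trans_le hp.1) (Icc_self (1 : ℝ) ▸ hsp)
  · exact hLp s (hsbar.1.le.trans hs.1) p (hpbar.1.trans_le hp.1) hsp
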